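/- Let $X$ be a connected compact complex manifold of dimension $n$, $L=-K_X$, and let $h_0$ be a smooth Hermitian metric on $L$ whose Chern curvature form $\omega_0=-\frac{\sqrt{-1}}{2\pi}\partial\bar\partial\log h_0$ is positive (so that $X$ is Fano). Put $V=\int_X\omega_0^n$, let $\rho_0\in C^\infty(X;\mathbb R)$ be the Ricci potential, $\mathrm{Ric}(\omega_0)-\omega_0=\frac{\sqrt{-1}}{2\pi}\partial\bar\partial\rho_0$ with $\int_X(e^{\rho_0}-1)\,\omega_0^n=0$, and set $$d\mu_0=e^{\rho_0}\omega_0^n,\qquad d\mu_\phi=\frac{e^{-\phi}d\mu_0}{\int_X e^{-\phi}d\mu_0},\qquad L(\phi)=-\log\frac1V\int_X e^{-\phi}d\mu_0 .$$ Let $k\ge 1$ be an integer such that $kL$ is globally generated, let $N_k=\dim H^0(X,kL)$, and let $\mathcal H_k$ be the set of positive definite Hermitian inner products on $H^0(X,kL)$. For $H\in\mathcal H_k$ and any $H$-orthonormal basis $(s_i)$ put $$f_k(H)=\frac1k\log\frac1{N_k}\sum_{i=1}^{N_k}|s_i|^2_{h_0^{k}},\qquad b_k(H)(s,s')=\int_X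 h_0^{k}(s,s')\,e^{-kf_k(H)}\,d\mu_{f_k(H)},$$ and define the quantized entropy $$S_k(H)=\frac1{N_k}\operatorname{Tr}\, b_k(H)\big(\log b_k(H)-\log H\big),$$ where $b_k(H)$ and $H$ are identified with Hermitian matrices by means of an $H$-orthonormal basis (the value does not depend on it); this is the quantum relative entropy $\operatorname{Tr}A(\log A-\log B)$ of $A=b_k(H)/N_k$ and $B=H/N_k$. Let $(H_t)$ be a solution on a set of times $I\subset\mathbb R$ (for instance $I=(0,\infty)$) of the quantized Kähler–Ricci flow $$\frac1k\frac{d}{dt}\log H=\log b_k(H)-\log H ,$$ understood as an equation of tangent vectors of $\mathcal H_k$: at each time $t\in I$, in every $H_t$-orthonormal basis, the matrix of $\frac1k\dot H_t$ is the logarithm of the matrix of $b_k(H_t)$. (Derivatives in $t$ are taken within $I$.) Then for every $t\in I$ the function $L\circ f_k(H_t)$ is differentiable at $t$ and $$S_k(H_t)=-\frac{d}{dt}L(f_k(H_t)).$$ Moreover there are bases $(s_i)$ of $H^0(X,kL)$ which are $H_t$-orthonormal and $b_k(H_t)$-orthogonal, and for every such basis $$S_k(H_t)=-\sum_{i}\frac{\lambda_i}{k}\,\frac{\|s_i\|^2_{b_k(H_t)}}{N_k}-\log\Big(\frac1{N_k}\sum_i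 e^{-\lambda_i/k}\Big),\qquad \lambda_i=-k\log\|s_i\|^2_{b_k(H_t)} .$$ -/

import Mathlib

open scoped Manifold ContDiff ComplexConjugate ComplexOrder
open MeasureTheory Set

noncomputable section

namespace QuantizedKRF

/-! ### The line bundle `-kK_X` and its holomorphic sections -/

lemma contDiff_detPow (n k : ℕ) : ContDiff ℂ ω
    (fun A : (Fin n → ℂ) →L[ℂ] (Fin n → ℂ) =>
      (LinearMap.det (A : (Fin n → ℂ) →ₗ[ℂ] (Fin n → ℂ))) ^ k) := by
  refine ContDiff.pow ?_ k
  have h : (fun A : (Fin n → ℂ) →L[ℂ] (Fin n → ℂ) =>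
      LinearMap.det (A : (Fin n → ℂ) →ₗ[ℂ] (Fin n → ℂ))) =
      fun A => ∑ σ : Equiv.Perm (Fin n), ((Equiv.Perm.sign σ : ℤ) : ℂ) *
        ∏ i, A (Pi.single i 1) (σ i) := by
    funext A
    rw [← LinearMap.det_toMatrix', Matrix.det_apply']
    simp [LinearMap.toMatrix'_apply]
  rw [h]
  refine ContDiff.sum fun σ _ => contDiff_const.mul (contDiff_prod fun i _ => ?_)
  have h2 : ContDiff ℂ ω (fun A : (Fin n → ℂ) →L[ℂ] (Fin n → ℂ) => A (Pi.single i (1 : ℂ))) :=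
    contDiff_id.clm_apply contDiff_const
  exact (contDiff_apply ℂ ℂ (σ i)).comp h2

section Bundle

variable (n : ℕ) (X : Type*) [TopologicalSpace X] [ChartedSpace (Fin n → ℂ) X]
  [IsManifold 𝓘(ℂ, Fin n → ℂ) ω X]

/-- The line bundle `-kK_X = (Λⁿ TX)^{⊗k}`: over each chart of the atlas it is trivialised by the
frame `(∂/∂z₁ ∧ ⋯ ∧ ∂/∂zₙ)^{⊗k}`, and the change of coordinates from one chart to another is the
`k`-th power of the determinant of the one of the holomorphic tangent bundle. -/
def antiCanonicalCore (k : ℕ) : VectorBundleCore ℂ X ℂ (atlas (Fin n → ℂ) X) where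
  baseSet i := i.1.source
  isOpen_baseSet i := i.1.open_source
  indexAt := achart (Fin n → ℂ)
  mem_baseSet_at := mem_chart_source (Fin n → ℂ)
  coordChange i j x :=
    ((LinearMap.det ((tangentBundleCore 𝓘(ℂ, Fin n → ℂ) X).coordChange i j x :
      (Fin n → ℂ) →ₗ[ℂ] (Fin n → ℂ))) ^ k) • ContinuousLinearMap.id ℂ ℂ
  coordChange_self i x hx v := by
    have h : ((tangentBundleCore 𝓘(ℂ, Fin n → ℂ) X).coordChange i i x :
        (Fin n → ℂ) →ₗ[ℂ] (Fin n → ℂ)) = LinearMap.id :=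
      LinearMap.ext fun w => (tangentBundleCore 𝓘(ℂ, Fin n → ℂ) X).coordChange_self i x hx w
    rw [h]; simp
  continuousOn_coordChange i j := by
    have h : Continuous fun A : (Fin n → ℂ) →L[ℂ] (Fin n → ℂ) =>
        ((LinearMap.det (A : (Fin n → ℂ) →ₗ[ℂ] (Fin n → ℂ))) ^ k) •
          ContinuousLinearMap.id ℂ ℂ :=
      (contDiff_detPow n k).continuous.smul continuous_const
    exact h.comp_continuousOn
      ((tangentBundleCore 𝓘(ℂ, Fin n → ℂ) X).continuousOn_coordChange i j)
  coordChange_comp i j l x hx v := by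
    have h : ((tangentBundleCore 𝓘(ℂ, Fin n → ℂ) X).coordChange i l x :
        (Fin n → ℂ) →ₗ[ℂ] (Fin n → ℂ)) =
        ((tangentBundleCore 𝓘(ℂ, Fin n → ℂ) X).coordChange j l x :
          (Fin n → ℂ) →ₗ[ℂ] (Fin n → ℂ)) ∘ₗ
        ((tangentBundleCore 𝓘(ℂ, Fin n → ℂ) X).coordChange i j x :
          (Fin n → ℂ) →ₗ[ℂ] (Fin n → ℂ)) :=
      LinearMap.ext fun w =>
        ((tangentBundleCore 𝓘(ℂ, Fin n → ℂ) X).coordChange_comp i j l x hx w).symm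
    rw [h, LinearMap.det_comp]
    simp [mul_pow, mul_assoc]

/-- The transition functions of `-kK_X` are holomorphic. -/
instance antiCanonicalCore_isContMDiff (k : ℕ) :
    (antiCanonicalCore n X k).IsContMDiff 𝓘(ℂ, Fin n → ℂ) ω where
  contMDiffOn_coordChange i j := by
    have h : (tangentBundleCore 𝓘(ℂ, Fin n → ℂ) X).IsContMDiff 𝓘(ℂ, Fin n → ℂ) ω :=
      tangentBundleCore.isContMDiff (n := ω)
    have h2 : ContDiff ℂ ω (fun A : (Fin n → ℂ) →L[ℂ] (Fin n → ℂ) =>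
        ((LinearMap.det (A : (Fin n → ℂ) →ₗ[ℂ] (Fin n → ℂ))) ^ k) •
          ContinuousLinearMap.id ℂ ℂ) :=
      (contDiff_detPow n k).smul contDiff_const
    exact h2.contMDiff.comp_contMDiffOn (h.contMDiffOn_coordChange i j)

/-- `H⁰(X, -kK_X)`, the space of holomorphic (complex-analytic) sections. -/
abbrev HolSection (k : ℕ) : Type _ :=
  Cₛ^ω⟮𝓘(ℂ, Fin n → ℂ); ℂ, (antiCanonicalCore n X k).Fiber⟯

/-- `N_k = dim H⁰(X, -kK_X)`. -/
abbrev dimSection (k : ℕ) : ℕ := Module.finrank ℂ (HolSection n X k)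

end Bundle

lemma exists_chartPartition {n : ℕ} {X : Type*} [TopologicalSpace X]
    [ChartedSpace (Fin n → ℂ) X] [CompactSpace X] [T2Space X] : ∃ χ : PartitionOfUnity X X univ,
    χ.IsSubordinate fun x => (chartAt (Fin n → ℂ) x).source :=
  PartitionOfUnity.exists_isSubordinate isClosed_univ _
    (fun x => (chartAt (Fin n → ℂ) x).open_source)
    (fun x _ => mem_iUnion.2 ⟨x, mem_chart_source (Fin n → ℂ) x⟩)

variable {n : ℕ} {X : Type*} [TopologicalSpace X] [ChartedSpace (Fin n → ℂ) X]
  [IsManifold 𝓘(ℂ, Fin n → ℂ) ω X]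

/-- The coefficient of a section of `-kK_X` at `x`, with respect to the frame
`(∂/∂z₁ ∧ ⋯ ∧ ∂/∂zₙ)^{⊗k}` of the preferred chart at `x`. -/
def coeff {k : ℕ} (s : HolSection n X k) (x : X) : ℂ := s x

/-! ### Hermitian metrics, curvature and measures -/

/-- The complex Hessian `∂²u/∂z_i∂z̄_j` of a real function `u` on `ℂⁿ`, where
`4 ∂²/∂z_i∂z̄_j = ∂²/∂x_i∂x_j + ∂²/∂y_i∂y_j + √-1 (∂²/∂x_i∂y_j - ∂²/∂y_i∂x_j)`. -/
def complexHessian (u : (Fin n → ℂ) → ℝ) (z : Fin n → ℂ) : Matrix (Fin n) (Fin n) ℂ :=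
  Matrix.of fun i j =>
    let D : (Fin n → ℂ) → (Fin n → ℂ) → ℝ := fun v w => fderiv ℝ (fderiv ℝ u) z v w
    let ex : Fin n → (Fin n → ℂ) := fun l => Pi.single l 1
    let ey : Fin n → (Fin n → ℂ) := fun l => Pi.single l Complex.I
    (1 / 4 : ℂ) * (((D (ex i) (ex j) + D (ey i) (ey j) : ℝ) : ℂ) +
      Complex.I * ((D (ex i) (ey j) - D (ey i) (ex j) : ℝ) : ℂ))

variable (n X) in
/-- A smooth Hermitian metric on `-K_X`. The number `weight x` is the squared length of the frame
`∂/∂z₁ ∧ ⋯ ∧ ∂/∂zₙ` of the preferred chart at `x`; the squared length of the same frame of an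
arbitrary chart `e` has to be a smooth function on that chart. -/
structure HermitianMetric where
  weight : X → ℝ
  weight_pos : ∀ x, 0 < weight x
  smooth : ∀ e : atlas (Fin n → ℂ) X,
    ContDiffOn ℝ ∞ (fun z => weight (e.1.symm z) *
      ‖(antiCanonicalCore n X 1).coordChange e (achart (Fin n → ℂ) (e.1.symm z))
        (e.1.symm z) 1‖ ^ 2) e.1.target

namespace HermitianMetric

variable (h₀ : HermitianMetric n X)

/-- The squared length of the frame `∂/∂z₁ ∧ ⋯ ∧ ∂/∂zₙ` of the chart `e`, as a function of the
coordinate. -/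
def localWeight (e : atlas (Fin n → ℂ) X) (z : Fin n → ℂ) : ℝ :=
  h₀.weight (e.1.symm z) *
    ‖(antiCanonicalCore n X 1).coordChange e (achart (Fin n → ℂ) (e.1.symm z)) (e.1.symm z) 1‖ ^ 2

/-- The coefficients `g_{ij̄} = -∂²log h₀/∂z_i∂z̄_j`, in the chart `e`, of the Chern curvature form
`ω₀ = (√-1/2π) ∑ g_{ij̄} dz_i ∧ dz̄_j` of `h₀`. -/
def curvature (e : atlas (Fin n → ℂ) X) (z : Fin n → ℂ) : Matrix (Fin n) (Fin n) ℂ :=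
  complexHessian (fun y => -Real.log (h₀.localWeight e y)) z

/-- The curvature form `ω₀` is positive, i.e. it is a Kähler form. -/
def IsPositive : Prop :=
  ∀ e : atlas (Fin n → ℂ) X, ∀ z ∈ e.1.target, (h₀.curvature e z).PosDef

end HermitianMetric

section Measures

variable [CompactSpace X] [T2Space X] [MeasurableSpace X] [BorelSpace X]

variable (n X) in
/-- A partition of unity subordinate to the charts. -/
def chartPartition : PartitionOfUnity X X univ := (exists_chartPartition (n := n)).choose

/-- The measure on `X` given by a density: `w e` is the density with respect to Lebesgue measure in
the chart `e`, and the local measures are glued with a partition of unity. (When the densities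
transform correctly, as they do below, the result does not depend on the partition.) -/
def gluedMeasure (w : atlas (Fin n → ℂ) X → (Fin n → ℂ) → ℝ) : Measure X :=
  Measure.sum fun i : X =>
    ((volume.restrict (chartAt (Fin n → ℂ) i).target).withDensity fun z =>
      ENNReal.ofReal (chartPartition n X i ((chartAt (Fin n → ℂ) i).symm z) *
        w (achart (Fin n → ℂ) i) z)).map (chartAt (Fin n → ℂ) i).symm

variable (h₀ : HermitianMetric n X) (ρ₀ : X → ℝ)

/-- The measure `ω₀ⁿ`; in a chart, `ω₀ⁿ = n! π⁻ⁿ det(g_{ij̄})` times Lebesgue measure. -/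
def kahlerMeasure : Measure X :=
  gluedMeasure fun e z =>
    (n.factorial : ℝ) * (Real.pi⁻¹) ^ n * (h₀.curvature e z).det.re

/-- The volume `V = ∫_X ω₀ⁿ`. -/
def kahlerVolume : ℝ := (kahlerMeasure h₀ univ).toReal

/-- `ρ₀` is the normalised Ricci potential of `ω₀`: a smooth real function with
`Ric ω₀ - ω₀ = (√-1/2π) ∂∂̄ρ₀`, where `Ric ω₀ = -(√-1/2π) ∂∂̄ log det(g_{ij̄})`, and
`∫_X (e^{ρ₀} - 1) ω₀ⁿ = 0`. -/
structure IsRicciPotential : Prop where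
  smooth : ∀ e : atlas (Fin n → ℂ) X, ContDiffOn ℝ ∞ (ρ₀ ∘ e.1.symm) e.1.target
  ricci : ∀ e : atlas (Fin n → ℂ) X, ∀ z ∈ e.1.target,
    -complexHessian (fun y => Real.log (h₀.curvature e y).det.re) z - h₀.curvature e z =
      complexHessian (ρ₀ ∘ e.1.symm) z
  normalized : ∫ x, (Real.exp (ρ₀ x) - 1) ∂(kahlerMeasure h₀) = 0

/-- The measure `dμ₀ = e^{ρ₀} ω₀ⁿ`. -/
def refMeasure : Measure X :=
  (kahlerMeasure h₀).withDensity fun x => ENNReal.ofReal (Real.exp (ρ₀ x))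

/-- The canonical probability measure `dμ_φ = e^{-φ} dμ₀ / ∫_X e^{-φ} dμ₀`. -/
def canonicalMeasure (φ : X → ℝ) : Measure X :=
  (∫⁻ x, ENNReal.ofReal (Real.exp (-φ x)) ∂(refMeasure h₀ ρ₀))⁻¹ •
    (refMeasure h₀ ρ₀).withDensity fun x => ENNReal.ofReal (Real.exp (-φ x))

/-- The functional `L(φ) = -log (V⁻¹ ∫_X e^{-φ} dμ₀)`. -/
def LFunctional (φ : X → ℝ) : ℝ :=
  -Real.log ((kahlerVolume h₀)⁻¹ * ∫ x, Real.exp (-φ x) ∂(refMeasure h₀ ρ₀))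

end Measures

/-! ### Hermitian inner products on the space of sections -/

variable (n X) in
/-- The space `𝓗_k` of positive definite Hermitian inner products on `H⁰(X, -kK_X)`
(conjugate-linear in the first variable). -/
abbrev HermInner (k : ℕ) : Type _ := InnerProductSpace.Core ℂ (HolSection n X k)

/-- `s` is an `H`-orthonormal basis of `H⁰(X, -kK_X)`. -/
structure IsOrthonormalBasis {k : ℕ} (H : HermInner n X k)
    (s : Fin (dimSection n X k) → HolSection n X k) : Prop where
  orthonormal : ∀ i j, H.inner (s i) (s j) = if i = j then 1 else 0
  span_eq_top : Submodule.span ℂ (range s) = ⊤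

/-- A choice of an `H`-orthonormal basis. -/
def orthonormalBasis {k : ℕ} (H : HermInner n X k) :
    Fin (dimSection n X k) → HolSection n X k :=
  Classical.epsilon (IsOrthonormalBasis H)

/-- The pointwise Hermitian product `h₀^{⊗k}(s, s')` of two sections of `-kK_X`. -/
def pointwiseInner (h₀ : HermitianMetric n X) {k : ℕ} (s s' : HolSection n X k) (x : X) : ℂ :=
  conj (coeff s x) * coeff s' x * ((h₀.weight x ^ k : ℝ) : ℂ)

/-- The Fubini–Study type map `f_k(H) = (1/k) log ((1/N_k) ∑ |s_i|²)`, for an `H`-orthonormal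
basis `s_i` and `|s|² = h₀^{⊗k}(s, s)`. -/
def fubiniStudy (h₀ : HermitianMetric n X) {k : ℕ} (H : HermInner n X k) (x : X) : ℝ :=
  (1 / (k : ℝ)) * Real.log ((1 / (dimSection n X k : ℝ)) *
    ∑ i, (pointwiseInner h₀ (orthonormalBasis H i) (orthonormalBasis H i) x).re)

/-- The matrix of a sesquilinear form with respect to a family of vectors. -/
def gram {V : Type*} {ι : Type*} (B : V → V → ℂ) (s : ι → V) : Matrix ι ι ℂ :=
  Matrix.of fun i j => B (s i) (s j)

/-- The logarithm of a (positive definite) Hermitian matrix. -/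
def matLog {ι : Type*} [Fintype ι] [DecidableEq ι] (A : Matrix ι ι ℂ) : Matrix ι ι ℂ :=
  cfc Real.log A

/-- The quantum relative entropy `S(A | B) = Tr A (log A - log B)`. -/
def relEntropy {ι : Type*} [Fintype ι] [DecidableEq ι] (A B : Matrix ι ι ℂ) : ℝ :=
  (A * (matLog A - matLog B)).trace.re

section Flow

variable [CompactSpace X] [T2Space X] [MeasurableSpace X] [BorelSpace X]
variable (h₀ : HermitianMetric n X) (ρ₀ : X → ℝ)

/-- The `L²` inner product `p_k(φ)(s, s') = ∫_X h₀^{⊗k}(s, s') e^{-kφ} dμ_φ`. -/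
def l2Form {k : ℕ} (φ : X → ℝ) (s s' : HolSection n X k) : ℂ :=
  ∫ x, pointwiseInner h₀ s s' x * ((Real.exp (-(k * φ x)) : ℝ) : ℂ) ∂(canonicalMeasure h₀ ρ₀ φ)

/-- The balancing map `b_k = p_k ∘ f_k`. -/
def balancing {k : ℕ} (H : HermInner n X k) : HolSection n X k → HolSection n X k → ℂ :=
  l2Form h₀ ρ₀ (fubiniStudy h₀ H)

/-- The quantized entropy `S_k(H) = S(b_k(H)/N_k | H/N_k) = (1/N_k) Tr b_k(H)(log b_k(H) - log H)`,
the Hermitian forms being identified with matrices by an `H`-orthonormal basis. -/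
def quantizedEntropy {k : ℕ} (H : HermInner n X k) : ℝ :=
  relEntropy ((1 / (dimSection n X k : ℂ)) • gram (balancing h₀ ρ₀ H) (orthonormalBasis H))
    ((1 / (dimSection n X k : ℂ)) • gram H.inner (orthonormalBasis H))

/-- The quantized Kähler–Ricci flow `(1/k) d/dt log H = log b_k(H) - log H` on a set `I` of times.
At each time `t`, Hermitian forms are identified with matrices by an `H_t`-orthonormal basis; `H_t`
is then the identity matrix, and `d/dt log H` is the tangent vector `H⁻¹ dH/dt` of the homogeneous
space `𝓗_k`, that is, the matrix of `dH/dt`. -/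
def IsQuantizedFlowOn {k : ℕ} (I : Set ℝ) (H : ℝ → HermInner n X k) : Prop :=
  ∀ t ∈ I, ∀ s, IsOrthonormalBasis (H t) s → ∀ i j,
    HasDerivWithinAt (fun τ => (H τ).inner (s i) (s j))
      ((k : ℂ) * (matLog (gram (balancing h₀ ρ₀ (H t)) s) - matLog (gram (H t).inner s)) i j) I t

end Flow

end QuantizedKRF

end

/-! Fix `t` and choose an `H_t`-orthonormal basis `s_i` diagonalising `b_k(H_t)`, with eigenvalues
`β_i > 0`. There `log H_t = 0`, so the flow says that the Gram matrix of `H` has derivative `diag(k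
log β_i)` at `t`, and the entropy is `(1/N_k) ∑ β_i log β_i` (`quantizedEntropy_eq`): the factors
`1/N_k` inside the two logarithms cancel.

The heart is the first variation of `L ∘ f_k` (`hasDerivWithinAt_LFunctional`). In a fixed basis,
`f_k(H) = (1/k) log ((1/N_k) tr(G⁻¹ Q(x)))`, with `G` the Gram matrix of `H` and `Q(x)` that of the
pointwise product (`fubiniStudy_eq`). At `G = 1` the derivative of `G⁻¹` is `-Ġ`; if `Ġ =
diag(d_i)`, then `f_k` varies by `-(1/k) ∑ d_i |s_i|² / ∑ |s_j|²`. The derivative of `L` at `φ` is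
integration against `dμ_φ`, and `e^{-k f_k} = N_k / ∑ |s_j|²`, so `β_i = N_k ∫ |s_i|² / ∑ |s_j|²
dμ_{f_k}` (`balancing_eq`). Hence `L ∘ f_k` has derivative `-(1/(k N_k)) ∑ β_i d_i`, which for `d_i
= k log β_i` is minus the entropy.

The same formula gives `∑ β_i = N_k` (`sum_balancing_self_re`). Since `e^{-λ_i/k} = β_i`, the last
term of the second identity is `log 1 = 0`.

Three analytic facts support this: `H⁰(X, kL)` is finite-dimensional
(`finiteDimensional_holSection`), by the Schwarz lemma and compactness; `μ₀` is finite and charges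
every nonempty open set; and one may differentiate under the integral
(`hasFDerivAt_integral_exp_log`). -/

noncomputable section

namespace QuantizedKRF

/-! ### Sections and metrics in local charts -/

section Sections

variable {n : ℕ} {X : Type*} [TopologicalSpace X] [ChartedSpace (Fin n → ℂ) X]
  [IsManifold 𝓘(ℂ, Fin n → ℂ) ω X] {k : ℕ}

/-- The coefficient of a section of `-kK_X` with respect to the frame of the chart `e`, as a
function of the coordinate. -/
def localCoeff (s : HolSection n X k) (e : atlas (Fin n → ℂ) X) (z : Fin n → ℂ) : ℂ :=
  (antiCanonicalCore n X k).coordChange (achart (Fin n → ℂ) (e.1.symm z)) e (e.1.symm z)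
    (coeff s (e.1.symm z))

lemma antiCanonicalCore_coordChange (i j : atlas (Fin n → ℂ) X) (x : X) (v : ℂ) :
    (antiCanonicalCore n X k).coordChange i j x v =
      (antiCanonicalCore n X 1).coordChange i j x 1 ^ k * v := by
  simp [antiCanonicalCore]

lemma coeff_add (s s' : HolSection n X k) (x : X) : coeff (s + s') x = coeff s x + coeff s' x := by
  simp only [coeff, ContMDiffSection.coe_add]
  rfl

lemma coeff_smul (c : ℂ) (s : HolSection n X k) (x : X) : coeff (c • s) x = c * coeff s x := by
  simp only [coeff, ContMDiffSection.coe_smul]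
  rfl

lemma ext_coeff {s s' : HolSection n X k} (h : ∀ x, coeff s x = coeff s' x) : s = s' :=
  ContMDiffSection.ext h

/-- Evaluation of the coefficient at a point, as a linear form. -/
def coeffLinear (x : X) : HolSection n X k →ₗ[ℂ] ℂ where
  toFun s := coeff s x
  map_add' s s' := coeff_add s s' x
  map_smul' c s := coeff_smul c s x

/-- The coefficient in a chart, as a linear map. -/
def localCoeffLinear (e : atlas (Fin n → ℂ) X) : HolSection n X k →ₗ[ℂ] (Fin n → ℂ) → ℂ where
  toFun s := localCoeff s e
  map_add' s s' := by
    funext z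
    simp only [localCoeff, coeff_add, map_add, Pi.add_apply]
  map_smul' c s := by
    funext z
    simp only [localCoeff, coeff_smul, Pi.smul_apply, RingHom.id_apply, smul_eq_mul]
    rw [← smul_eq_mul, map_smul, smul_eq_mul]

lemma coeff_eq_localCoeff (s : HolSection n X k) (e : atlas (Fin n → ℂ) X) {x : X}
    (hx : x ∈ e.1.source) :
    coeff s x = (antiCanonicalCore n X 1).coordChange e (achart (Fin n → ℂ) x) x 1 ^ k *
      localCoeff s e (e.1 x) := by
  rw [← antiCanonicalCore_coordChange, localCoeff, e.1.left_inv hx]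
  have hx' : x ∈ (achart (Fin n → ℂ) x).1.source := mem_chart_source (Fin n → ℂ) x
  exact ((antiCanonicalCore n X k).coordChange_comp _ e _ x ⟨⟨hx', hx⟩, hx'⟩ _).trans
    ((antiCanonicalCore n X k).coordChange_self _ x hx' _) |>.symm

lemma contMDiffOn_localCoeff (s : HolSection n X k) (e : atlas (Fin n → ℂ) X) :
    ContMDiffOn 𝓘(ℂ, Fin n → ℂ) 𝓘(ℂ, ℂ) ω (fun x => localCoeff s e (e.1 x)) e.1.source := by
  have : MemTrivializationAtlas ((antiCanonicalCore n X k).localTriv e) := ⟨⟨e, rfl⟩⟩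
  have h := (Bundle.Trivialization.contMDiffOn_section_baseSet_iff
    (IB := 𝓘(ℂ, Fin n → ℂ)) (n := ω) (s := fun x => s x)
    ((antiCanonicalCore n X k).localTriv e)).1 s.contMDiff.contMDiffOn
  refine h.congr fun x hx => ?_
  rw [localCoeff, e.1.left_inv hx]
  rfl

lemma contDiffOn_localCoeff (s : HolSection n X k) (e : atlas (Fin n → ℂ) X) :
    ContDiffOn ℂ ω (localCoeff s e) e.1.target := by
  rw [← contMDiffOn_iff_contDiffOn]
  have he : ContMDiffOn 𝓘(ℂ, Fin n → ℂ) 𝓘(ℂ, Fin n → ℂ) ω e.1.symm e.1.target :=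
    contMDiffOn_symm_of_mem_maximalAtlas (IsManifold.subset_maximalAtlas e.2)
  refine ((contMDiffOn_localCoeff s e).comp he fun z hz => e.1.map_target hz).congr fun z hz => ?_
  simp [e.1.right_inv hz]

/-- `pointwiseInner` uses the preferred chart at each point, which may jump with the point. Here a
single chart is used throughout its domain: the frame change contributes `‖d‖ ^ (2k)`, which
`localWeight ^ k` absorbs. Continuity and all local estimates rest on this. -/
lemma pointwiseInner_eq_local (h₀ : HermitianMetric n X) (s s' : HolSection n X k)
    (e : atlas (Fin n → ℂ) X) {x : X} (hx : x ∈ e.1.source) :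
    pointwiseInner h₀ s s' x = conj (localCoeff s e (e.1 x)) * localCoeff s' e (e.1 x) *
      ((h₀.localWeight e (e.1 x) ^ k : ℝ) : ℂ) := by
  rw [pointwiseInner, coeff_eq_localCoeff s e hx, coeff_eq_localCoeff s' e hx,
    HermitianMetric.localWeight, e.1.left_inv hx]
  set d := (antiCanonicalCore n X 1).coordChange e (achart (Fin n → ℂ) x) x 1
  have hd : ((‖d‖ ^ 2 : ℝ) : ℂ) = conj d * d := by
    rw [← Complex.normSq_eq_norm_sq, Complex.normSq_eq_conj_mul_self]
  rw [mul_pow, Complex.ofReal_mul, Complex.ofReal_pow (‖d‖ ^ 2), hd]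
  simp only [map_mul, map_pow, mul_pow]
  ring

lemma HermitianMetric.contDiffOn_localWeight (h₀ : HermitianMetric n X)
    (e : atlas (Fin n → ℂ) X) : ContDiffOn ℝ ∞ (h₀.localWeight e) e.1.target :=
  h₀.smooth e

lemma coordChange_ne_zero (i j : atlas (Fin n → ℂ) X) {x : X} (hi : x ∈ i.1.source)
    (hj : x ∈ j.1.source) : (antiCanonicalCore n X 1).coordChange i j x 1 ≠ 0 := by
  intro h0
  have h1 := (antiCanonicalCore n X 1).coordChange_comp i j i x ⟨⟨hi, hj⟩, hi⟩ 1
  rw [h0, map_zero, (antiCanonicalCore n X 1).coordChange_self i x hi] at h1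
  exact zero_ne_one h1

lemma HermitianMetric.localWeight_pos (h₀ : HermitianMetric n X) (e : atlas (Fin n → ℂ) X)
    {z : Fin n → ℂ} (hz : z ∈ e.1.target) : 0 < h₀.localWeight e z := by
  have := coordChange_ne_zero e (achart (Fin n → ℂ) (e.1.symm z)) (e.1.map_target hz)
    (mem_chart_source (Fin n → ℂ) _)
  have h := h₀.weight_pos (e.1.symm z)
  unfold HermitianMetric.localWeight
  positivity

lemma continuous_pointwiseInner (h₀ : HermitianMetric n X) (s s' : HolSection n X k) :
    Continuous (pointwiseInner h₀ s s') := by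
  rw [continuous_iff_continuousAt]
  intro x
  let e := achart (Fin n → ℂ) x
  have hx : x ∈ e.1.source := mem_chart_source (Fin n → ℂ) x
  have hs : e.1.source ∈ nhds x := e.1.open_source.mem_nhds hx
  have hw : ContinuousOn (fun y => h₀.localWeight e (e.1 y)) e.1.source :=
    (h₀.contDiffOn_localWeight e).continuousOn.comp e.1.continuousOn fun y hy => e.1.map_source hy
  have hc (s : HolSection n X k) := (contMDiffOn_localCoeff s e).continuousOn
  have h : ContinuousOn (fun y => conj (localCoeff s e (e.1 y)) * localCoeff s' e (e.1 y) *
      ((h₀.localWeight e (e.1 y) ^ k : ℝ) : ℂ)) e.1.source :=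
    ((Complex.continuous_conj.comp_continuousOn (hc s)).mul (hc s')).mul
      (Complex.continuous_ofReal.comp_continuousOn (hw.pow k))
  refine (h.continuousAt hs).congr ?_
  filter_upwards [hs] with y hy using (pointwiseInner_eq_local h₀ s s' e hy).symm

end Sections

/-! ### Finite-dimensionality of the space of sections -/

section FiniteDimension

open Filter Topology Asymptotics

/-- A holomorphic function whose derivatives of order at most `m` vanish at `c` is small near
`c`. -/
lemma norm_le_of_iteratedFDeriv_eq_zero {E : Type*} [NormedAddCommGroup E] [NormedSpace ℂ E]
    {f : E → ℂ} {c : E} {r B : ℝ} {m : ℕ} (hr : 0 < r)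
    (hd : DifferentiableOn ℂ f (Metric.ball c (2 * r))) (ha : AnalyticAt ℂ f c)
    (hB : ∀ z ∈ Metric.ball c (2 * r), ‖f z‖ ≤ B)
    (h0 : ∀ j ≤ m, iteratedFDeriv ℂ j f c = 0) {z : E} (hz : z ∈ Metric.ball c r) :
    ‖f z‖ ≤ B * (1 / 2) ^ (m + 1) := by
  have hfc : f c = 0 := by
    have := congrArg (fun A => A 0) (h0 0 (Nat.zero_le m))
    simpa using this
  obtain ⟨p, R, hp⟩ := ha
  have hsum : ∀ y, p.partialSum (m + 1) y = 0 := by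
    intro y
    refine Finset.sum_eq_zero fun j hj => ?_
    have h := hp.factorial_smul y j
    rw [h0 j (Nat.lt_succ_iff.1 (Finset.mem_range.1 hj))] at h
    simpa [Nat.factorial_ne_zero] using h
  have hO := hp.hasFPowerSeriesAt.isBigO_sub_partialSum_pow (m + 1)
  simp only [hsum, sub_zero] at hO
  -- Weakening `O(‖y‖ ^ (m + 1))` to `o(‖y‖ ^ m)` costs nothing: the higher-order Schwarz lemma
  -- starts from the latter and returns the exponent `m + 1`.
  have ho : (fun y : E => f (c + y)) =o[𝓝 0] fun y => ‖y‖ ^ m := by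
    refine hO.trans_isLittleO ?_
    have h := (isLittleO_pow_pow (𝕜 := ℝ) (Nat.lt_succ_self m)).comp_tendsto
      (tendsto_norm_zero (E := E))
    exact h
  have ho' : (f · - f c) =o[𝓝 c] fun w => ‖w - c‖ ^ m := by
    have ht : Tendsto (fun w : E => w - c) (𝓝 c) (𝓝 0) := by
      have : Continuous fun w : E => w - c := by fun_prop
      simpa using this.tendsto c
    simpa [Function.comp_def, hfc] using ho.comp_tendsto ht
  have hzr : dist z c < r := hz
  have key := Complex.dist_le_mul_div_pow_of_mapsTo_ball_of_isLittleO hd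
    (fun w hw => by simpa [hfc] using hB w hw) ho'
    (Metric.ball_subset_ball (by linarith) hz)
  rw [hfc, dist_zero_right] at key
  refine key.trans ?_
  have hB0 : 0 ≤ B := (norm_nonneg _).trans (hB c (Metric.mem_ball_self (by linarith)))
  have h2 : dist z c / (2 * r) ≤ 1 / 2 := by
    rw [div_le_div_iff₀ (by linarith) two_pos]
    linarith
  gcongr

variable {n : ℕ} {X : Type*} [TopologicalSpace X] [ChartedSpace (Fin n → ℂ) X]
  [IsManifold 𝓘(ℂ, Fin n → ℂ) ω X] {k : ℕ}

lemma analyticAt_localCoeff (s : HolSection n X k) (e : atlas (Fin n → ℂ) X) {z : Fin n → ℂ}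
    (hz : z ∈ e.1.target) : AnalyticAt ℂ (localCoeff s e) z :=
  ((contDiffOn_localCoeff s e).contDiffAt (e.1.open_target.mem_nhds hz)).analyticAt

/-- The derivatives of order at most `m` at `x` of the coefficient of a section in the preferred
chart at `x`. -/
def jet (m : ℕ) (x : X) : HolSection n X k →ₗ[ℂ]
    ((j : Fin (m + 1)) → MultilinearMap ℂ (fun _ : Fin j => Fin n → ℂ) ℂ) where
  toFun s j := (iteratedFDeriv ℂ j (localCoeff s (achart (Fin n → ℂ) x))
    (chartAt (Fin n → ℂ) x x)).toMultilinearMap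
  map_add' s s' := by
    funext j
    have h (s : HolSection n X k) : ContDiffAt ℂ j (localCoeff s (achart (Fin n → ℂ) x))
        (chartAt (Fin n → ℂ) x x) :=
      (analyticAt_localCoeff s (achart (Fin n → ℂ) x) (mem_chart_target (Fin n → ℂ) x)).contDiffAt
    have h2 : localCoeff (s + s') (achart (Fin n → ℂ) x) =
        localCoeff s (achart (Fin n → ℂ) x) + localCoeff s' (achart (Fin n → ℂ) x) :=
      (localCoeffLinear _).map_add s s'
    rw [h2, iteratedFDeriv_add_apply (h s) (h s')]
    rfl
  map_smul' c s := by
    funext j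
    have h : ContDiffAt ℂ j (localCoeff s (achart (Fin n → ℂ) x))
        (chartAt (Fin n → ℂ) x x) :=
      (analyticAt_localCoeff s (achart (Fin n → ℂ) x) (mem_chart_target (Fin n → ℂ) x)).contDiffAt
    have h2 : localCoeff (c • s) (achart (Fin n → ℂ) x) =
        c • localCoeff s (achart (Fin n → ℂ) x) :=
      (localCoeffLinear _).map_smul c s
    rw [h2, iteratedFDeriv_const_smul_apply h]
    rfl

/-- The squared pointwise norm of a section. -/
def normSq (h₀ : HermitianMetric n X) (s : HolSection n X k) (x : X) : ℝ :=
  (pointwiseInner h₀ s s x).re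

lemma continuous_normSq (h₀ : HermitianMetric n X) (s : HolSection n X k) :
    Continuous (normSq h₀ s) :=
  Complex.continuous_re.comp (continuous_pointwiseInner h₀ s s)

lemma normSq_eq (h₀ : HermitianMetric n X) (s : HolSection n X k) (x : X) :
    normSq h₀ s x = ‖coeff s x‖ ^ 2 * h₀.weight x ^ k := by
  rw [normSq, pointwiseInner, ← Complex.normSq_eq_conj_mul_self, ← Complex.ofReal_mul,
    Complex.ofReal_re, Complex.normSq_eq_norm_sq]

lemma normSq_nonneg (h₀ : HermitianMetric n X) (s : HolSection n X k) (x : X) :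
    0 ≤ normSq h₀ s x := by
  rw [normSq_eq]
  have := h₀.weight_pos x
  positivity

lemma normSq_eq_zero {h₀ : HermitianMetric n X} {s : HolSection n X k} {x : X} :
    normSq h₀ s x = 0 ↔ coeff s x = 0 := by
  rw [normSq_eq]
  have := (pow_pos (h₀.weight_pos x) k).ne'
  simp [this]

lemma normSq_eq_local (h₀ : HermitianMetric n X) (s : HolSection n X k)
    (e : atlas (Fin n → ℂ) X) {x : X} (hx : x ∈ e.1.source) :
    normSq h₀ s x = ‖localCoeff s e (e.1 x)‖ ^ 2 * h₀.localWeight e (e.1 x) ^ k := by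
  rw [normSq, pointwiseInner_eq_local h₀ s s e hx, ← Complex.normSq_eq_conj_mul_self,
    ← Complex.ofReal_mul, Complex.ofReal_re, Complex.normSq_eq_norm_sq]

/-- Near `x`, a section whose jet of order `m` at `x` vanishes is small compared with its supremum
norm, uniformly in the section. -/
lemma exists_nhds_normSq_le (h₀ : HermitianMetric n X) (k : ℕ) (x : X) :
    ∃ U ∈ 𝓝 x, ∃ C : ℝ, ∀ (m : ℕ) (s : HolSection n X k), jet m x s = 0 →
      ∀ M : ℝ, (∀ y, normSq h₀ s y ≤ M) → ∀ y ∈ U, normSq h₀ s y ≤ C * M * (1 / 4) ^ (m + 1) := by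
  let e := achart (Fin n → ℂ) x
  have hx : x ∈ e.1.source := mem_chart_source (Fin n → ℂ) x
  have hex : e.1 x ∈ e.1.target := e.1.map_source hx
  obtain ⟨R, hR, hRt⟩ := Metric.nhds_basis_closedBall.mem_iff.1 (e.1.open_target.mem_nhds hex)
  have hcpt : IsCompact (Metric.closedBall (e.1 x) R) := isCompact_closedBall _ _
  have hne : (Metric.closedBall (e.1 x) R).Nonempty := ⟨_, Metric.mem_closedBall_self hR.le⟩
  have hwc : ContinuousOn (h₀.localWeight e) (Metric.closedBall (e.1 x) R) :=
    (h₀.contDiffOn_localWeight e).continuousOn.mono hRt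
  obtain ⟨a, ha, hmin⟩ := hcpt.exists_isMinOn hne hwc
  obtain ⟨b, hb, hmax⟩ := hcpt.exists_isMaxOn hne hwc
  have hapos := h₀.localWeight_pos e (hRt ha)
  set δ := h₀.localWeight e a
  set W := h₀.localWeight e b
  have hball : Metric.ball (e.1 x) (2 * (R / 2)) ⊆ Metric.closedBall (e.1 x) R := by
    rw [mul_div_cancel₀ _ two_ne_zero]
    exact Metric.ball_subset_closedBall
  have hU : e.1.source ∩ e.1 ⁻¹' Metric.ball (e.1 x) (R / 2) ∈ 𝓝 x :=
    (e.1.continuousOn.isOpen_inter_preimage e.1.open_source Metric.isOpen_ball).mem_nhds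
      ⟨hx, Metric.mem_ball_self (half_pos hR)⟩
  -- The constant compares the extreme values of the weight on a closed ball. It depends on neither
  -- `m` nor `s`, so `m` can be chosen after a finite cover has been extracted.
  refine ⟨_, hU, W ^ k / δ ^ k, fun m s hs M hM y hy => ?_⟩
  have hM0 : 0 ≤ M := (normSq_nonneg h₀ s x).trans (hM x)
  have hder : ∀ j ≤ m, iteratedFDeriv ℂ j (localCoeff s e) (e.1 x) = 0 := by
    intro j hj
    have h := congrFun hs ⟨j, Nat.lt_succ_of_le hj⟩
    exact ContinuousMultilinearMap.toMultilinearMap_injective h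
  have hbound : ∀ z ∈ Metric.ball (e.1 x) (2 * (R / 2)),
      ‖localCoeff s e z‖ ≤ Real.sqrt (M / δ ^ k) := by
    intro z hz
    have hzt := hRt (hball hz)
    apply Real.le_sqrt_of_sq_le
    rw [le_div_iff₀ (by positivity)]
    have h := hM (e.1.symm z)
    rw [normSq_eq_local h₀ s e (e.1.map_target hzt), e.1.right_inv hzt] at h
    refine le_trans ?_ h
    gcongr
    exact hmin (hball hz)
  have hsmall := norm_le_of_iteratedFDeriv_eq_zero (half_pos hR)
    (fun z hz => (analyticAt_localCoeff s e (hRt (hball hz))).differentiableAt.differentiableWithinAt)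
    (analyticAt_localCoeff s e hex) hbound hder hy.2
  have hwy : h₀.localWeight e (e.1 y) ≤ W :=
    hmax (hball (Metric.ball_subset_ball (by linarith) hy.2))
  have hwy0 := h₀.localWeight_pos e (e.1.map_source hy.1)
  rw [normSq_eq_local h₀ s e hy.1]
  calc ‖localCoeff s e (e.1 y)‖ ^ 2 * h₀.localWeight e (e.1 y) ^ k
      ≤ (Real.sqrt (M / δ ^ k) * (1 / 2) ^ (m + 1)) ^ 2 * W ^ k := by gcongr
    _ = W ^ k / δ ^ k * M * (1 / 4) ^ (m + 1) := by
      rw [mul_pow, Real.sq_sqrt (by positivity), ← pow_mul, mul_comm (m + 1) 2, pow_mul]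
      norm_num
      ring

/-- The space of holomorphic sections of `-kK_X` over a compact manifold is finite-dimensional. -/
theorem finiteDimensional_holSection [CompactSpace X] (h₀ : HermitianMetric n X) (k : ℕ) :
    FiniteDimensional ℂ (HolSection n X k) := by
  choose U hU C hC using exists_nhds_normSq_le h₀ k
  obtain ⟨T, hT⟩ := CompactSpace.elim_nhds_subcover U hU
  obtain ⟨D, hD⟩ : ∃ D : ℝ, ∀ x ∈ T, C x ≤ D :=
    let ⟨D, hD⟩ := (T.image C).bddAbove
    ⟨D, fun x hx => hD (Finset.mem_coe.2 (Finset.mem_image_of_mem C hx))⟩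
  obtain ⟨m, hm⟩ : ∃ m : ℕ, D * (1 / 4) ^ (m + 1) < 1 := by
    have h : Tendsto (fun m : ℕ => D * (1 / 4 : ℝ) ^ (m + 1)) atTop (𝓝 (D * 0)) :=
      ((tendsto_pow_atTop_nhds_zero_of_lt_one (by norm_num) (by norm_num)).comp
        (tendsto_add_atTop_nat 1)).const_mul D
    rw [mul_zero] at h
    exact (h.eventually_lt_const one_pos).exists
  -- Finitely many jets of bounded order form a finite-dimensional space, so it suffices that they
  -- determine the section.
  let J : HolSection n X k →ₗ[ℂ]
      (T → (j : Fin (m + 1)) → MultilinearMap ℂ (fun _ : Fin j => Fin n → ℂ) ℂ) :=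
    LinearMap.pi fun x => jet m x.1
  refine FiniteDimensional.of_injective J ((injective_iff_map_eq_zero J).2 fun s hs => ?_)
  refine ext_coeff fun x => ?_
  have hX : Nonempty X := ⟨x⟩
  -- At a maximum point of the norm, the local estimate bounds the maximum by itself times `D * (1 /
  -- 4) ^ (m + 1) < 1`, which forces it to vanish.
  obtain ⟨y, -, hy⟩ := isCompact_univ.exists_isMaxOn univ_nonempty
    (continuous_normSq h₀ s).continuousOn
  have hyM : ∀ z, normSq h₀ s z ≤ normSq h₀ s y := fun z => hy (mem_univ z)
  have hyU : y ∈ ⋃ x ∈ T, U x := hT ▸ mem_univ y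
  simp only [mem_iUnion] at hyU
  obtain ⟨x', hx', hyx'⟩ := hyU
  have h1 := hC x' m s (congrFun hs ⟨x', hx'⟩) _ hyM y hyx'
  have h0 := normSq_nonneg h₀ s y
  have h2 : C x' * normSq h₀ s y * (1 / 4) ^ (m + 1) ≤
      D * (1 / 4) ^ (m + 1) * normSq h₀ s y := by
    rw [mul_right_comm]
    gcongr
    exact hD x' hx'
  have h3 : normSq h₀ s y = 0 := by nlinarith
  have h4 : normSq h₀ s x = 0 := le_antisymm (h3 ▸ hyM x) (normSq_nonneg h₀ s x)
  rw [normSq_eq_zero.1 h4]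
  rfl

end FiniteDimension

/-! ### Finiteness and positivity of the measures -/

section MeasureProperties

open Filter Topology

lemma continuousOn_complexHessian {n : ℕ} {u : (Fin n → ℂ) → ℝ} {s : Set (Fin n → ℂ)}
    (hs : IsOpen s) (hu : ContDiffOn ℝ ∞ u s) : ContinuousOn (complexHessian u) s := by
  have h1 : ContDiffOn ℝ 1 (fderiv ℝ u) s := hu.fderiv_of_isOpen hs (by norm_cast)
  have h2 : ContinuousOn (fderiv ℝ (fderiv ℝ u)) s := h1.continuousOn_fderiv_of_isOpen hs le_rfl
  have hD (v w : Fin n → ℂ) : ContinuousOn (fun z => fderiv ℝ (fderiv ℝ u) z v w) s :=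
    (h2.clm_apply continuousOn_const).clm_apply continuousOn_const
  refine continuousOn_pi.2 fun i => continuousOn_pi.2 fun j => ?_
  refine continuousOn_const.mul ((Complex.continuous_ofReal.comp_continuousOn
    ((hD _ _).add (hD _ _))).add (continuousOn_const.mul
    (Complex.continuous_ofReal.comp_continuousOn ((hD _ _).sub (hD _ _)))))

variable {n : ℕ} {X : Type*} [TopologicalSpace X] [ChartedSpace (Fin n → ℂ) X]

lemma chartPartition_isSubordinate [CompactSpace X] [T2Space X] :
    (chartPartition n X).IsSubordinate fun x => (chartAt (Fin n → ℂ) x).source :=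
  (exists_chartPartition (n := n) (X := X)).choose_spec

lemma aemeasurable_chart_symm [MeasurableSpace X] [BorelSpace X] (i : X) : AEMeasurable (chartAt (Fin n → ℂ) i).symm
    (volume.restrict (chartAt (Fin n → ℂ) i).target) :=
  (chartAt (Fin n → ℂ) i).continuousOn_symm.aemeasurable
    (chartAt (Fin n → ℂ) i).open_target.measurableSet

section Glued

variable [CompactSpace X] [T2Space X] [MeasurableSpace X] [BorelSpace X]

/-- By compactness only finitely many functions of the partition are nonzero, and each is supported
in a compact subset of its chart, where the continuous density is bounded. -/
lemma isFiniteMeasure_gluedMeasure {w : atlas (Fin n → ℂ) X → (Fin n → ℂ) → ℝ}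
    (hw : ∀ e, ContinuousOn (w e) e.1.target) : IsFiniteMeasure (gluedMeasure w) := by
  have hfin : {i : X | (Function.support (chartPartition n X i)).Nonempty}.Finite :=
    (chartPartition n X).locallyFinite.finite_nonempty_of_compact
  refine ⟨?_⟩
  rw [gluedMeasure, Measure.sum_apply _ MeasurableSet.univ,
    tsum_eq_sum (s := hfin.toFinset) (fun i hi => ?_)]
  · refine ENNReal.sum_lt_top.2 fun i _ => ?_
    let e := achart (Fin n → ℂ) i
    have hcpt : IsCompact (e.1 '' tsupport (chartPartition n X i)) :=
      (isClosed_tsupport _).isCompact.image_of_continuousOn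
        (e.1.continuousOn.mono (chartPartition_isSubordinate i))
    have hsub : e.1 '' tsupport (chartPartition n X i) ⊆ e.1.target := by
      rintro _ ⟨x, hx, rfl⟩
      exact e.1.map_source (chartPartition_isSubordinate i hx)
    obtain ⟨C, hC⟩ := hcpt.exists_bound_of_continuousOn ((hw e).mono hsub)
    rw [Measure.map_apply_of_aemeasurable ((aemeasurable_chart_symm i).mono_ac
      (withDensity_absolutelyContinuous _ _)) MeasurableSet.univ, preimage_univ,
      withDensity_apply _ MeasurableSet.univ, Measure.restrict_univ]
    have hle : ∀ z ∈ e.1.target, ENNReal.ofReal (chartPartition n X i (e.1.symm z) * w e z) ≤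
        (e.1 '' tsupport (chartPartition n X i)).indicator (fun _ => ENNReal.ofReal C) z := by
      intro z hz
      by_cases hK : z ∈ e.1 '' tsupport (chartPartition n X i)
      · rw [indicator_of_mem hK]
        refine ENNReal.ofReal_le_ofReal ?_
        refine (le_abs_self _).trans ?_
        rw [abs_mul, abs_of_nonneg ((chartPartition n X).nonneg i _)]
        exact (mul_le_of_le_one_left (abs_nonneg _) ((chartPartition n X).le_one i _)).trans (hC z hK)
      · rw [indicator_of_notMem hK, image_eq_zero_of_notMem_tsupport
          (fun h => hK ⟨_, h, e.1.right_inv hz⟩)]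
        simp
    refine (setLIntegral_mono' e.1.open_target.measurableSet hle).trans_lt ?_
    refine (setLIntegral_le_lintegral _ _).trans_lt ?_
    rw [lintegral_indicator hcpt.measurableSet, setLIntegral_const]
    exact ENNReal.mul_lt_top ENNReal.ofReal_lt_top hcpt.measure_lt_top
  · have h0 : ∀ x, chartPartition n X i x = 0 := by
      intro x
      by_contra hx
      exact hi (hfin.mem_toFinset.2 ⟨x, hx⟩)
    simp [h0, Measure.map_zero]

/-- Around any point some function of the partition is positive, so the corresponding summand has
positive density on a nonempty open subset of its chart. -/
lemma isOpenPosMeasure_gluedMeasure {w : atlas (Fin n → ℂ) X → (Fin n → ℂ) → ℝ}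
    (hw : ∀ e, ContinuousOn (w e) e.1.target) (hpos : ∀ e, ∀ z ∈ e.1.target, 0 < w e z) :
    (gluedMeasure w).IsOpenPosMeasure := by
  refine ⟨fun U hU ⟨x, hx⟩ h0 => ?_⟩
  obtain ⟨i, hi⟩ := (chartPartition n X).exists_pos (mem_univ x)
  let e := achart (Fin n → ℂ) i
  have hxe : x ∈ e.1.source := chartPartition_isSubordinate i (subset_tsupport _ hi.ne')
  have hχ : Continuous (chartPartition n X i) := (chartPartition n X i).continuous
  have hopen : IsOpen (e.1.target ∩ e.1.symm ⁻¹' (U ∩ {y | 0 < chartPartition n X i y})) :=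
    e.1.continuousOn_symm.isOpen_inter_preimage e.1.open_target
      (hU.inter (isOpen_lt continuous_const hχ))
  have hmeas : AEMeasurable (fun z => ENNReal.ofReal (chartPartition n X i (e.1.symm z) * w e z))
      (volume.restrict e.1.target) :=
    ((hχ.comp_continuousOn e.1.continuousOn_symm).mul (hw e)).aemeasurable
      e.1.open_target.measurableSet |>.ennreal_ofReal
  have h1 := (Measure.sum_apply_eq_zero' hU.measurableSet).1 h0 i
  rw [Measure.map_apply_of_aemeasurable ((aemeasurable_chart_symm i).mono_ac
    (withDensity_absolutelyContinuous _ _)) hU.measurableSet] at h1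
  have h2 := (withDensity_apply_eq_zero' hmeas).1 h1
  have hsub : e.1.target ∩ e.1.symm ⁻¹' (U ∩ {y | 0 < chartPartition n X i y}) ⊆
      ({z | ENNReal.ofReal (chartPartition n X i (e.1.symm z) * w e z) ≠ 0} ∩ e.1.symm ⁻¹' U) ∩
        e.1.target := by
    rintro z ⟨hz, hzU, hzχ⟩
    refine ⟨⟨?_, hzU⟩, hz⟩
    exact (ENNReal.ofReal_pos.2 (mul_pos hzχ (hpos e z hz))).ne'
  rw [Measure.restrict_apply₀' e.1.open_target.measurableSet.nullMeasurableSet] at h2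
  refine (hopen.measure_pos volume ⟨e.1 x, e.1.map_source hxe, ?_⟩).ne' (measure_mono_null hsub h2)
  rw [mem_preimage, e.1.left_inv hxe]
  exact ⟨hx, hi⟩

end Glued

variable [IsManifold 𝓘(ℂ, Fin n → ℂ) ω X]

lemma continuousOn_curvature (h₀ : HermitianMetric n X) (e : atlas (Fin n → ℂ) X) :
    ContinuousOn (h₀.curvature e) e.1.target :=
  continuousOn_complexHessian e.1.open_target
    ((h₀.contDiffOn_localWeight e).log fun _ hz => (h₀.localWeight_pos e hz).ne').neg

lemma continuousOn_kahlerDensity (h₀ : HermitianMetric n X) (e : atlas (Fin n → ℂ) X) :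
    ContinuousOn (fun z => (n.factorial : ℝ) * (Real.pi⁻¹) ^ n * (h₀.curvature e z).det.re)
      e.1.target :=
  continuousOn_const.mul (Complex.continuous_re.comp_continuousOn
    ((continuous_id.matrix_det).comp_continuousOn (continuousOn_curvature h₀ e)))

lemma IsRicciPotential.continuous [CompactSpace X] [T2Space X] [MeasurableSpace X] [BorelSpace X]
    {h₀ : HermitianMetric n X} {ρ₀ : X → ℝ} (hρ : IsRicciPotential h₀ ρ₀) : Continuous ρ₀ := by
  rw [continuous_iff_continuousAt]
  intro x
  let e := achart (Fin n → ℂ) x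
  have hs : e.1.source ∈ 𝓝 x := e.1.open_source.mem_nhds (mem_chart_source (Fin n → ℂ) x)
  have h : ContinuousOn (fun y => (ρ₀ ∘ e.1.symm) (e.1 y)) e.1.source :=
    (hρ.smooth e).continuousOn.comp e.1.continuousOn fun y hy => e.1.map_source hy
  refine (h.continuousAt hs).congr ?_
  filter_upwards [hs] with y hy using by simp [e.1.left_inv hy]

variable [CompactSpace X] [T2Space X] [MeasurableSpace X] [BorelSpace X]

lemma isFiniteMeasure_kahlerMeasure (h₀ : HermitianMetric n X) :
    IsFiniteMeasure (kahlerMeasure h₀) :=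
  isFiniteMeasure_gluedMeasure (continuousOn_kahlerDensity h₀)

lemma isOpenPosMeasure_kahlerMeasure {h₀ : HermitianMetric n X} (hpos : h₀.IsPositive) :
    (kahlerMeasure h₀).IsOpenPosMeasure := by
  refine isOpenPosMeasure_gluedMeasure (continuousOn_kahlerDensity h₀) fun e z hz => ?_
  have h := (Complex.pos_iff.1 (hpos e z hz).det_pos).1
  have := Real.pi_pos
  positivity

lemma kahlerVolume_pos [Nonempty X] {h₀ : HermitianMetric n X} (hpos : h₀.IsPositive) :
    0 < kahlerVolume h₀ := by
  have := isFiniteMeasure_kahlerMeasure h₀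
  have := isOpenPosMeasure_kahlerMeasure hpos
  exact ENNReal.toReal_pos (isOpen_univ.measure_pos _ univ_nonempty).ne' (measure_ne_top _ _)

lemma isFiniteMeasure_refMeasure (h₀ : HermitianMetric n X) {ρ₀ : X → ℝ} (hρ : Continuous ρ₀) :
    IsFiniteMeasure (refMeasure h₀ ρ₀) := by
  have := isFiniteMeasure_kahlerMeasure h₀
  have hc : Continuous fun x => Real.exp (ρ₀ x) := Real.continuous_exp.comp hρ
  have hi : Integrable (fun x => Real.exp (ρ₀ x)) (kahlerMeasure h₀) :=
    hc.integrable_of_hasCompactSupport (HasCompactSupport.of_compactSpace _)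
  exact isFiniteMeasure_withDensity_ofReal hi.2

lemma isOpenPosMeasure_refMeasure {h₀ : HermitianMetric n X} (hpos : h₀.IsPositive) {ρ₀ : X → ℝ}
    (hρ : Continuous ρ₀) : (refMeasure h₀ ρ₀).IsOpenPosMeasure := by
  have := isOpenPosMeasure_kahlerMeasure hpos
  refine Measure.AbsolutelyContinuous.isOpenPosMeasure (μ := kahlerMeasure h₀) ?_
  refine withDensity_absolutelyContinuous' ?_ ?_
  · exact (Real.continuous_exp.comp hρ).measurable.ennreal_ofReal.aemeasurable
  · exact Eventually.of_forall fun x => (ENNReal.ofReal_pos.2 (Real.exp_pos _)).ne'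

/-- Integration against the canonical probability measure. -/
lemma integral_canonicalMeasure (h₀ : HermitianMetric n X) (ρ₀ : X → ℝ)
    [IsFiniteMeasure (refMeasure h₀ ρ₀)] {φ : X → ℝ} (hφ : Continuous φ) (g : X → ℂ) :
    ∫ x, g x ∂(canonicalMeasure h₀ ρ₀ φ) = (∫ x, Real.exp (-φ x) ∂(refMeasure h₀ ρ₀))⁻¹ •
      ∫ x, Real.exp (-φ x) • g x ∂(refMeasure h₀ ρ₀) := by
  have hc : Continuous fun x => Real.exp (-φ x) := Real.continuous_exp.comp hφ.neg
  have hi : Integrable (fun x => Real.exp (-φ x)) (refMeasure h₀ ρ₀) :=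
    hc.integrable_of_hasCompactSupport (HasCompactSupport.of_compactSpace _)
  rw [canonicalMeasure, integral_smul_measure, ENNReal.toReal_inv,
    ← ofReal_integral_eq_lintegral_ofReal hi (Eventually.of_forall fun x => (Real.exp_pos _).le),
    ENNReal.toReal_ofReal (integral_nonneg fun x => (Real.exp_pos _).le),
    integral_withDensity_eq_integral_toReal_smul hc.measurable.ennreal_ofReal
      (Eventually.of_forall fun x => ENNReal.ofReal_lt_top)]
  simp only [ENNReal.toReal_ofReal (Real.exp_pos _).le]

end MeasureProperties

/-! ### Gram matrices, matrix logarithms and orthonormal bases -/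

section LinearAlgebra

open Matrix

/-- The family of combinations `∑ⱼ P j i • s j`. -/
def comb {V ι : Type*} [AddCommGroup V] [Module ℂ V] [Fintype ι] (s : ι → V) (P : Matrix ι ι ℂ)
    (i : ι) : V :=
  ∑ j, P j i • s j

section Forms

variable {V ι : Type*} [AddCommGroup V] [Module ℂ V] [Fintype ι]

lemma comb_comb (s : ι → V) (P Q : Matrix ι ι ℂ) : comb (comb s P) Q = comb s (P * Q) := by
  funext i
  simp only [comb, Finset.smul_sum, smul_smul, Matrix.mul_apply, Finset.sum_smul]
  rw [Finset.sum_comm]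
  simp only [mul_comm]

lemma comb_one [DecidableEq ι] (s : ι → V) : comb s 1 = s := by
  funext i
  simp [comb, Matrix.one_apply]

lemma exists_eq_comb {s : ι → V} (hs : Submodule.span ℂ (range s) = ⊤) (t : ι → V) :
    ∃ P, t = comb s P := by
  have h (i : ι) : ∃ c : ι → ℂ, ∑ j, c j • s j = t i :=
    (Submodule.mem_span_range_iff_exists_fun ℂ).1 (hs ▸ Submodule.mem_top)
  choose c hc using h
  exact ⟨fun j i => c i j, funext fun i => (hc i).symm⟩

lemma span_comb [DecidableEq ι] {s : ι → V} (hs : Submodule.span ℂ (range s) = ⊤)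
    {P Q : Matrix ι ι ℂ} (hPQ : P * Q = 1) : Submodule.span ℂ (range (comb s P)) = ⊤ := by
  rw [eq_top_iff, ← hs, Submodule.span_le]
  rintro _ ⟨i, rfl⟩
  have h : s i = comb (comb s P) Q i := by rw [comb_comb, hPQ, comb_one]
  rw [h]
  exact Submodule.sum_mem _ fun j _ => Submodule.smul_mem _ _ (Submodule.subset_span ⟨j, rfl⟩)

lemma gram_comb (B : V →ₗ⋆[ℂ] V →ₗ[ℂ] ℂ) (s : ι → V) (P : Matrix ι ι ℂ) :
    gram (fun x y => B x y) (comb s P) = Pᴴ * gram (fun x y => B x y) s * P := by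
  ext i j
  simp only [gram, comb, Matrix.of_apply, Matrix.mul_apply, map_sum, LinearMap.sum_apply,
    LinearMap.map_smulₛₗ, LinearMap.smul_apply, smul_eq_mul, Matrix.conjTranspose_apply,
    Finset.mul_sum, Finset.sum_mul, RingHom.id_apply, starRingEnd_apply]
  refine Finset.sum_congr rfl fun a _ => Finset.sum_congr rfl fun b _ => ?_
  ring

end Forms

section MatLog

variable {ι : Type*} [Fintype ι] [DecidableEq ι]

lemma aeval_diagonal (p : Polynomial ℝ) (d : ι → ℝ) :
    Polynomial.aeval (Matrix.diagonal fun i => (d i : ℂ)) p = Matrix.diagonal fun i => ((p.eval (d i) : ℝ) : ℂ) := by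
  induction p using Polynomial.induction_on' with
  | add p q hp hq =>
    rw [map_add, hp, hq, diagonal_add]
    simp
  | monomial m a =>
    rw [Polynomial.aeval_monomial, diagonal_pow, Matrix.algebraMap_eq_diagonal, diagonal_mul_diagonal]
    simp

/-- The spectrum lies in the range of `d`, where `Real.log` agrees with a Lagrange interpolation
polynomial; polynomials commute with conjugation by a unitary and act entrywise on diagonal
matrices. No positivity of `d` is needed. -/
lemma matLog_conj_diagonal {P : Matrix ι ι ℂ} (hP : Pᴴ * P = 1) (d : ι → ℝ) :
    matLog (Pᴴ * Matrix.diagonal (fun i => (d i : ℂ)) * P) =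
      Pᴴ * Matrix.diagonal (fun i => ((Real.log (d i) : ℝ) : ℂ)) * P := by
  have hP' : P * Pᴴ = 1 := mul_eq_one_comm.1 hP
  let φ : Matrix ι ι ℂ →ₐ[ℝ] Matrix ι ι ℂ :=
    AlgHom.ofLinearMap ((LinearMap.mulLeft ℝ Pᴴ).comp (LinearMap.mulRight ℝ P))
      (by simp [hP]) (fun x y => by
        simp only [LinearMap.comp_apply, LinearMap.mulLeft_apply, LinearMap.mulRight_apply]
        calc Pᴴ * (x * y * P) = Pᴴ * (x * (1 * y) * P) := by rw [one_mul]
          _ = Pᴴ * (x * P) * (Pᴴ * (y * P)) := by rw [← hP']; simp only [mul_assoc])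
  have hφ (x : Matrix ι ι ℂ) : φ x = Pᴴ * x * P := by
    simp [φ, mul_assoc]
  set A := Pᴴ * Matrix.diagonal (fun i => (d i : ℂ)) * P with hA
  have hsa : IsSelfAdjoint A := by
    rw [isSelfAdjoint_iff, star_eq_conjTranspose, hA]
    simp only [conjTranspose_mul, conjTranspose_conjTranspose, diagonal_conjTranspose, mul_assoc]
    congr 3
    funext i
    simp
  have hspec : spectrum ℝ A ⊆ range d := by
    rw [← hφ] at hA
    rw [hA]
    refine (AlgHom.spectrum_apply_subset φ _).trans fun r hr => ?_
    have h := spectrum.algebraMap_mem ℂ hr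
    rw [spectrum_diagonal] at h
    obtain ⟨i, hi⟩ := h
    exact ⟨i, Complex.ofReal_injective hi⟩
  -- The nodes are the distinct values of `d`, so repeated eigenvalues cause no trouble.
  let p : Polynomial ℝ := Lagrange.interpolate (Finset.univ.image d) id Real.log
  have hp (i : ι) : p.eval (d i) = Real.log (d i) :=
    Lagrange.eval_interpolate_at_node (v := id) _ (fun _ _ _ _ h => h)
      (Finset.mem_image_of_mem d (Finset.mem_univ i))
  have h1 : matLog A = cfc (fun x => p.eval x) A := by
    refine cfc_congr fun x hx => ?_
    obtain ⟨i, rfl⟩ := hspec hx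
    exact (hp i).symm
  rw [h1, cfc_polynomial p A hsa, hA, ← hφ, Polynomial.aeval_algHom_apply, aeval_diagonal, hφ]
  simp only [hp]

lemma matLog_diagonal (d : ι → ℝ) :
    matLog (Matrix.diagonal fun i => (d i : ℂ)) = Matrix.diagonal fun i => ((Real.log (d i) : ℝ) : ℂ) := by
  simpa using matLog_conj_diagonal (P := (1 : Matrix ι ι ℂ)) (by simp) d

lemma matLog_one : matLog (1 : Matrix ι ι ℂ) = 0 := by
  simpa using matLog_diagonal fun _ : ι => (1 : ℝ)

/-- The relative entropy of two positive definite matrices which are simultaneously diagonal in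
some orthonormal basis, the second one being scalar. -/
lemma relEntropy_conj_diagonal {P : Matrix ι ι ℂ} (hP : Pᴴ * P = 1) {d : ι → ℝ}
    (hd : ∀ i, 0 < d i) {c : ℝ} (hc : 0 < c) :
    relEntropy ((c : ℂ) • (Pᴴ * Matrix.diagonal (fun i => (d i : ℂ)) * P)) ((c : ℂ) • 1) =
      c * ∑ i, d i * Real.log (d i) := by
  have hP' : P * Pᴴ = 1 := mul_eq_one_comm.1 hP
  have h1 : (c : ℂ) • (Pᴴ * Matrix.diagonal (fun i => (d i : ℂ)) * P) =
      Pᴴ * Matrix.diagonal (fun i => ((c * d i : ℝ) : ℂ)) * P := by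
    have h : Matrix.diagonal (fun i => ((c * d i : ℝ) : ℂ)) = (c : ℂ) • Matrix.diagonal fun i => (d i : ℂ) := by
      rw [← diagonal_smul]
      congr 1
      funext i
      simp
    rw [h, Matrix.mul_smul, Matrix.smul_mul]
  have h2 : (c : ℂ) • (1 : Matrix ι ι ℂ) = Pᴴ * Matrix.diagonal (fun _ => (c : ℂ)) * P := by
    rw [← smul_one_eq_diagonal, Matrix.mul_smul, Matrix.smul_mul, mul_one, hP]
  rw [relEntropy, h1, h2, matLog_conj_diagonal hP, matLog_conj_diagonal hP fun _ => c,
    ← Matrix.sub_mul, ← Matrix.mul_sub, diagonal_sub]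
  have h3 (D E : Matrix ι ι ℂ) : (Pᴴ * D * P * (Pᴴ * E * P)).trace = (D * E).trace := by
    calc (Pᴴ * D * P * (Pᴴ * E * P)).trace = (Pᴴ * (D * (P * Pᴴ) * E * P)).trace := by
          simp only [mul_assoc]
      _ = (D * E).trace := by
          rw [trace_mul_comm, hP', mul_one, mul_assoc, hP', mul_one]
  rw [h3, diagonal_mul_diagonal, trace_diagonal, Complex.re_sum, Finset.mul_sum]
  refine Finset.sum_congr rfl fun i _ => ?_
  -- Since `log (c d) - log c = log d`, the scaling survives only as the outer factor `c`.
  rw [← Complex.ofReal_sub, ← Complex.ofReal_mul, Complex.ofReal_re,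
    Real.log_mul hc.ne' (hd i).ne']
  ring

end MatLog

section Bases

variable {n : ℕ} {X : Type*} [TopologicalSpace X] [ChartedSpace (Fin n → ℂ) X]
  [IsManifold 𝓘(ℂ, Fin n → ℂ) ω X] {k : ℕ}

/-- An inner product as a sesquilinear map. -/
def innerForm (H : HermInner n X k) : HolSection n X k →ₗ⋆[ℂ] HolSection n X k →ₗ[ℂ] ℂ :=
  LinearMap.mk₂'ₛₗ (starRingEnd ℂ) (RingHom.id ℂ) H.inner H.add_left (fun c x y => H.smul_left x y c)
    (fun x y z => by
      rw [← H.conj_inner_symm, H.add_left, map_add, H.conj_inner_symm, H.conj_inner_symm])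
    (fun c x y => by
      rw [← H.conj_inner_symm, H.smul_left, map_mul, H.conj_inner_symm]
      simp)

lemma gram_inner_comb (H : HermInner n X k) (s : Fin (dimSection n X k) → HolSection n X k)
    (P : Matrix _ _ ℂ) : gram H.inner (comb s P) = Pᴴ * gram H.inner s * P :=
  gram_comb (innerForm H) s P

lemma isOrthonormalBasis_iff {H : HermInner n X k}
    {s : Fin (dimSection n X k) → HolSection n X k} :
    IsOrthonormalBasis H s ↔ gram H.inner s = 1 ∧ Submodule.span ℂ (range s) = ⊤ := by
  constructor
  · rintro ⟨h1, h2⟩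
    refine ⟨?_, h2⟩
    ext i j
    rw [gram, Matrix.of_apply, h1, Matrix.one_apply]
  · rintro ⟨h1, h2⟩
    refine ⟨fun i j => ?_, h2⟩
    rw [← Matrix.one_apply, ← h1]
    rfl

lemma exists_isOrthonormalBasis [FiniteDimensional ℂ (HolSection n X k)] (H : HermInner n X k) :
    ∃ s, IsOrthonormalBasis H s := by
  let i1 : NormedAddCommGroup (HolSection n X k) := H.toNormedAddCommGroup
  let i2 : InnerProductSpace ℂ (HolSection n X k) := InnerProductSpace.ofCore H.toCore
  let b := stdOrthonormalBasis ℂ (HolSection n X k)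
  refine ⟨b, ⟨fun i j => ?_, ?_⟩⟩
  · exact orthonormal_iff_ite.1 b.orthonormal i j
  · rw [← b.coe_toBasis]
    exact b.toBasis.span_eq

/-- The basis picked by `Classical.epsilon` is meaningful only once one exists, which requires
finite dimension. -/
lemma isOrthonormalBasis_orthonormalBasis [FiniteDimensional ℂ (HolSection n X k)]
    (H : HermInner n X k) : IsOrthonormalBasis H (orthonormalBasis H) :=
  Classical.epsilon_spec (exists_isOrthonormalBasis H)

lemma IsOrthonormalBasis.ne_zero {H : HermInner n X k}
    {s : Fin (dimSection n X k) → HolSection n X k} (hs : IsOrthonormalBasis H s) (i : Fin (dimSection n X k)) :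
    s i ≠ 0 := by
  intro h
  have h1 := hs.orthonormal i i
  rw [h, if_pos rfl] at h1
  have h2 : H.inner (0 : HolSection n X k) 0 = 0 := by
    rw [← zero_smul ℂ (0 : HolSection n X k), H.smul_left]
    simp
  exact zero_ne_one (h2.symm.trans h1)

lemma IsOrthonormalBasis.comb {H : HermInner n X k}
    {s : Fin (dimSection n X k) → HolSection n X k} (hs : IsOrthonormalBasis H s)
    {P : Matrix _ _ ℂ} (hP : Pᴴ * P = 1) : IsOrthonormalBasis H (comb s P) := by
  rw [isOrthonormalBasis_iff] at hs ⊢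
  exact ⟨by rw [gram_inner_comb, hs.1, mul_one, hP], span_comb hs.2 (mul_eq_one_comm.1 hP)⟩

lemma IsOrthonormalBasis.exists_comb {H : HermInner n X k}
    {s t : Fin (dimSection n X k) → HolSection n X k} (hs : IsOrthonormalBasis H s)
    (ht : IsOrthonormalBasis H t) :
    ∃ P : Matrix _ _ ℂ, Pᴴ * P = 1 ∧ t = QuantizedKRF.comb s P := by
  rw [isOrthonormalBasis_iff] at hs ht
  obtain ⟨P, rfl⟩ := exists_eq_comb hs.2 t
  refine ⟨P, ?_, rfl⟩
  rw [gram_inner_comb, hs.1, mul_one] at ht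
  exact ht.1

/-- A Hermitian form can be diagonalised in an orthonormal basis. -/
lemma exists_isOrthonormalBasis_diagonal [FiniteDimensional ℂ (HolSection n X k)]
    (H : HermInner n X k) (B : HolSection n X k →ₗ⋆[ℂ] HolSection n X k →ₗ[ℂ] ℂ)
    (hB : ∀ s s', conj (B s' s) = B s s') :
    ∃ s, IsOrthonormalBasis H s ∧ ∀ i j, i ≠ j → B (s i) (s j) = 0 := by
  obtain ⟨s, hs⟩ := exists_isOrthonormalBasis H
  have hA : (gram (fun x y => B x y) s).IsHermitian := by
    ext i j
    exact hB _ _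
  let U : Matrix (Fin (dimSection n X k)) (Fin (dimSection n X k)) ℂ := hA.eigenvectorUnitary
  have hU : Uᴴ * U = 1 := Unitary.coe_star_mul_self hA.eigenvectorUnitary
  refine ⟨comb s U, hs.comb hU, fun i j hij => ?_⟩
  have h2 : gram (fun x y => B x y) (comb s U) =
      Matrix.diagonal (RCLike.ofReal ∘ hA.eigenvalues) := by
    rw [gram_comb]
    have h3 := hA.spectral_theorem
    rw [Unitary.conjStarAlgAut_apply] at h3
    conv_lhs => rw [h3]
    change Uᴴ * (U * _ * Uᴴ) * U = _
    calc Uᴴ * (U * Matrix.diagonal (RCLike.ofReal ∘ hA.eigenvalues) * Uᴴ) * U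
        = (Uᴴ * U) * Matrix.diagonal (RCLike.ofReal ∘ hA.eigenvalues) * (Uᴴ * U) := by
          simp only [mul_assoc]
      _ = _ := by rw [hU, one_mul, mul_one]
  have h4 := congrFun (congrFun h2 i) j
  rw [diagonal_apply_ne _ hij] at h4
  exact h4

end Bases

end LinearAlgebra

/-! ### Differentiation under the integral and of the matrix inverse -/

section Analysis

open Filter Topology

lemma integrable_of_compactSpace {X E : Type*} [TopologicalSpace X] [CompactSpace X]
    [MeasurableSpace X] [OpensMeasurableSpace X] {μ : Measure X} [IsFiniteMeasure μ]
    [NormedAddCommGroup E] {f : X → E} (hf : Continuous f) : Integrable f μ :=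
  hf.integrable_of_hasCompactSupport (HasCompactSupport.of_compactSpace f)

/-- Differentiation under the integral of `∫ exp (-(a log (b T_x A))) dμ(x)`, where `T_x` are
continuous linear forms depending continuously on `x` in a compact space. -/
lemma hasFDerivAt_integral_exp_log {X W : Type*} [TopologicalSpace X] [CompactSpace X]
    [MeasurableSpace X] [OpensMeasurableSpace X] [NormedAddCommGroup W] [NormedSpace ℝ W]
    {μ : Measure X} [IsFiniteMeasure μ] {T : X → W →L[ℝ] ℝ} (hT : Continuous T) {A₀ : W}
    (hpos : ∀ x, 0 < T x A₀) (a : ℝ) {b : ℝ} (hb : 0 < b) :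
    HasFDerivAt (fun A => ∫ x, Real.exp (-(a * Real.log (b * T x A))) ∂μ)
      (∫ x, (Real.exp (-(a * Real.log (b * T x A₀))) * (-(a / T x A₀))) • T x ∂μ) A₀ := by
  rcases isEmpty_or_nonempty X with hX | hX
  · simp only [Measure.eq_zero_of_isEmpty μ, integral_zero_measure]
    exact hasFDerivAt_const _ _
  have hTA (A : W) : Continuous fun x => T x A := hT.clm_apply continuous_const
  obtain ⟨x₁, -, hx₁⟩ := isCompact_univ.exists_isMinOn univ_nonempty (hTA A₀).continuousOn
  obtain ⟨x₂, -, hx₂⟩ := isCompact_univ.exists_isMaxOn univ_nonempty (hTA A₀).continuousOn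
  obtain ⟨K, hK⟩ := isCompact_univ.exists_bound_of_continuousOn hT.continuousOn
  have hδ := hpos x₁
  set δ := T x₁ A₀
  set C := T x₂ A₀
  have hK' : 0 < |K| + 1 := by positivity
  have hKx (x : X) : ‖T x‖ ≤ |K| + 1 := by linarith [hK x (mem_univ x), le_abs_self K]
  -- `δ` and `C` are the extreme values of `T x A₀`, and `|K| + 1` is a positive bound for `‖T x‖`.
  -- On a ball of this radius `T x A` moves by at most `δ / 2`, hence stays in one compact interval
  -- of positive numbers; this gives a constant dominating bound.
  have hball : ∀ A ∈ Metric.ball A₀ (δ / (2 * (|K| + 1))), ∀ x,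
      T x A ∈ Icc (δ / 2) (C + δ / 2) := by
    intro A hA x
    have h1 : ‖T x (A - A₀)‖ ≤ δ / 2 := by
      refine ((T x).le_opNorm _).trans ?_
      rw [Metric.mem_ball, dist_eq_norm] at hA
      calc ‖T x‖ * ‖A - A₀‖ ≤ (|K| + 1) * (δ / (2 * (|K| + 1))) := by
            gcongr
            exact hKx x
        _ = δ / 2 := by field_simp
    rw [map_sub, Real.norm_eq_abs, abs_le] at h1
    have h2 : δ ≤ T x A₀ := hx₁ (mem_univ x)
    have h3 : T x A₀ ≤ C := hx₂ (mem_univ x)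
    constructor <;> linarith
  have hcont : ContinuousOn (fun y : ℝ => Real.exp (-(a * Real.log (b * y))) * (-(a / y)))
      (Icc (δ / 2) (C + δ / 2)) := by
    have hne : ∀ y ∈ Icc (δ / 2) (C + δ / 2), y ≠ 0 := fun y hy => by
      have := hy.1
      exact (by linarith : 0 < y).ne'
    refine ContinuousOn.mul ?_ ((continuousOn_const.div continuousOn_id hne).neg)
    exact Real.continuous_exp.comp_continuousOn ((continuousOn_const.mul
      ((continuousOn_const.mul continuousOn_id).log fun y hy => mul_ne_zero hb.ne' (hne y hy))).neg)
  obtain ⟨D, hD⟩ := isCompact_Icc.exists_bound_of_continuousOn hcont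
  have hs : Metric.ball A₀ (δ / (2 * (|K| + 1))) ∈ 𝓝 A₀ := Metric.ball_mem_nhds _ (by positivity)
  have hA₀ := mem_of_mem_nhds hs
  have hgt {A : W} (hA : A ∈ Metric.ball A₀ (δ / (2 * (|K| + 1)))) (x : X) : 0 < T x A := by
    linarith [(hball A hA x).1]
  have hFc {A : W} (hA : A ∈ Metric.ball A₀ (δ / (2 * (|K| + 1)))) :
      Continuous fun x => Real.exp (-(a * Real.log (b * T x A))) :=
    Real.continuous_exp.comp (continuous_const.mul
      ((continuous_const.mul (hTA A)).log fun x => (mul_pos hb (hgt hA x)).ne')).neg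
  refine hasFDerivAt_integral_of_dominated_of_fderiv_le
    (F' := fun A x => (Real.exp (-(a * Real.log (b * T x A))) * (-(a / T x A))) • T x)
    (bound := fun _ => |D| * (|K| + 1)) hs ?_ ?_ ?_ ?_ (integrable_const _) ?_
  · filter_upwards [hs] with A hA using (integrable_of_compactSpace (hFc hA)).1
  · exact integrable_of_compactSpace (hFc hA₀)
  · have hc : Continuous fun x =>
        (Real.exp (-(a * Real.log (b * T x A₀))) * (-(a / T x A₀))) • T x :=
      ((hFc hA₀).mul ((continuous_const.div (hTA A₀) fun x => (hgt hA₀ x).ne').neg)).smul hT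
    exact (integrable_of_compactSpace hc).1
  · refine Eventually.of_forall fun x A hA => ?_
    rw [norm_smul]
    have h1 := (hD _ (hball A hA x)).trans (le_abs_self D)
    have h2 := hKx x
    gcongr
  · refine Eventually.of_forall fun x A hA => ?_
    have hy := hgt hA x
    have h1 : HasDerivAt (fun y : ℝ => Real.exp (-(a * Real.log (b * y))))
        (Real.exp (-(a * Real.log (b * T x A))) * (-(a / T x A))) (T x A) := by
      have h2 := (((hasDerivAt_id (T x A)).const_mul b).log (mul_pos hb hy).ne').const_mul a
      have h3 : a * (b * 1 / (b * T x A)) = a / T x A := by field_simp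
      refine h2.neg.exp.congr_deriv ?_
      change Real.exp (-(a * Real.log (b * T x A))) * -(a * (b * 1 / (b * T x A))) = _
      rw [h3]
    exact h1.comp_hasFDerivAt A (T x).hasFDerivAt

open Matrix in
/-- The derivative of `G⁻¹` at a point where `G` is the identity matrix. -/
lemma hasDerivWithinAt_matrix_inv {ι : Type*} [Fintype ι] [DecidableEq ι] {G : ℝ → Matrix ι ι ℂ}
    {M : Matrix ι ι ℂ} {I : Set ℝ} {t : ℝ} (hG : ∀ τ, IsUnit (G τ).det) (h1 : G t = 1)
    (hd : ∀ i j, HasDerivWithinAt (fun τ => G τ i j) (M i j) I t) (i j : ι) :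
    HasDerivWithinAt (fun τ => (G τ)⁻¹ i j) (-M i j) I t := by
  have hGc : Tendsto G (𝓝[I] t) (𝓝 1) := by
    rw [← h1]
    exact tendsto_pi_nhds.2 fun i => tendsto_pi_nhds.2 fun j => (hd i j).continuousWithinAt
  have hinv : Tendsto (fun τ => (G τ)⁻¹) (𝓝[I] t) (𝓝 1) := by
    have hc : ContinuousAt (fun N : Matrix ι ι ℂ => (N.det)⁻¹ • N.adjugate) 1 :=
      (continuous_id.matrix_det.continuousAt.inv₀ (by simp)).smul
        continuous_id.matrix_adjugate.continuousAt
    have h2 := hc.tendsto.comp hGc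
    simp only [det_one, adjugate_one, inv_one, one_smul] at h2
    refine h2.congr fun τ => ?_
    simp [Matrix.inv_def]
  rw [hasDerivWithinAt_iff_tendsto_slope]
  -- Because `G t = 1`, one has `G⁻¹ - 1 = -G⁻¹ (G - 1)`: the slope of `G⁻¹` is `-G⁻¹` times the
  -- slope of `G`, and `G⁻¹` tends to `1`.
  have hslope : Tendsto (fun τ => (τ - t)⁻¹ • (G τ - 1)) (𝓝[I \ {t}] t) (𝓝 M) := by
    refine tendsto_pi_nhds.2 fun i => tendsto_pi_nhds.2 fun j => ?_
    have h2 := hasDerivWithinAt_iff_tendsto_slope.1 (hd i j)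
    refine h2.congr fun τ => ?_
    simp [slope_def_module, h1]
  have hprod : Tendsto (fun τ => -((G τ)⁻¹ * ((τ - t)⁻¹ • (G τ - 1)))) (𝓝[I \ {t}] t)
      (𝓝 (-(1 * M))) :=
    (((hinv.mono_left (nhdsWithin_mono _ sdiff_subset)).mul hslope)).neg
  rw [one_mul] at hprod
  have h3 := tendsto_pi_nhds.1 (tendsto_pi_nhds.1 hprod i) j
  refine h3.congr fun τ => ?_
  have h4 : -((G τ)⁻¹ * ((τ - t)⁻¹ • (G τ - 1))) = (τ - t)⁻¹ • ((G τ)⁻¹ - (G t)⁻¹) := by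
    rw [Matrix.mul_smul, Matrix.mul_sub, Matrix.nonsing_inv_mul _ (hG τ), h1, inv_one, mul_one,
      ← smul_neg, neg_sub]
  rw [h4]
  simp [slope_def_module]

end Analysis

/-! ### The Bergman function, the map `f_k` and the balancing form -/

section Balancing

open Filter Topology Matrix

variable {n : ℕ} {X : Type*} [TopologicalSpace X] [ChartedSpace (Fin n → ℂ) X]
  [IsManifold 𝓘(ℂ, Fin n → ℂ) ω X] {k : ℕ}

/-- The pointwise product at `x` as a sesquilinear map. -/
def pointwiseForm (h₀ : HermitianMetric n X) (x : X) :
    HolSection n X k →ₗ⋆[ℂ] HolSection n X k →ₗ[ℂ] ℂ :=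
  LinearMap.mk₂'ₛₗ (starRingEnd ℂ) (RingHom.id ℂ) (fun s s' => pointwiseInner h₀ s s' x)
    (fun s s' r => by simp only [pointwiseInner, coeff_add, map_add]; ring)
    (fun c s r => by simp only [pointwiseInner, coeff_smul, map_mul, smul_eq_mul]; ring)
    (fun s r r' => by simp only [pointwiseInner, coeff_add]; ring)
    (fun c s r => by
      simp only [pointwiseInner, coeff_smul, smul_eq_mul, RingHom.id_apply]; ring)

lemma conj_pointwiseInner (h₀ : HermitianMetric n X) (s s' : HolSection n X k) (x : X) :
    conj (pointwiseInner h₀ s' s x) = pointwiseInner h₀ s s' x := by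
  simp only [pointwiseInner, map_mul, Complex.conj_conj, Complex.conj_ofReal]
  ring

lemma pointwiseInner_self (h₀ : HermitianMetric n X) (s : HolSection n X k) (x : X) :
    pointwiseInner h₀ s s x = (normSq h₀ s x : ℂ) :=
  (Complex.conj_eq_iff_re.1 (conj_pointwiseInner h₀ s s x)).symm

/-- The Bergman function `∑ᵢ |sᵢ|²` of a family of sections. -/
def bergman (h₀ : HermitianMetric n X) {ι : Type*} [Fintype ι] (s : ι → HolSection n X k)
    (x : X) : ℝ :=
  ∑ i, normSq h₀ (s i) x

lemma continuous_bergman (h₀ : HermitianMetric n X) {ι : Type*} [Fintype ι]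
    (s : ι → HolSection n X k) : Continuous (bergman h₀ s) :=
  continuous_finsetSum _ fun i _ => continuous_normSq h₀ (s i)

/-- If every `s i` vanished at `x`, so would all their combinations, contradicting the existence of
a section not vanishing there. -/
lemma bergman_pos (h₀ : HermitianMetric n X) {ι : Type*} [Fintype ι] {s : ι → HolSection n X k}
    (hs : Submodule.span ℂ (range s) = ⊤) {x : X} (hx : ∃ s : HolSection n X k, coeff s x ≠ 0) :
    0 < bergman h₀ s x := by
  obtain ⟨r, hr⟩ := hx
  refine lt_of_le_of_ne (Finset.sum_nonneg fun i _ => normSq_nonneg h₀ (s i) x) fun h => hr ?_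
  have h1 := (Finset.sum_eq_zero_iff_of_nonneg fun i _ => normSq_nonneg h₀ (s i) x).1 h.symm
  have h2 : Submodule.span ℂ (range s) ≤ LinearMap.ker (coeffLinear x) := by
    rw [Submodule.span_le]
    rintro _ ⟨i, rfl⟩
    exact normSq_eq_zero.1 (h1 i (Finset.mem_univ i))
  exact h2 (hs ▸ Submodule.mem_top : r ∈ Submodule.span ℂ (range s))

lemma trace_gram_pointwise (h₀ : HermitianMetric n X) {ι : Type*} [Fintype ι]
    (s : ι → HolSection n X k) (x : X) :
    (gram (fun r r' => pointwiseInner h₀ r r' x) s).trace.re = bergman h₀ s x := by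
  rw [trace, Complex.re_sum]
  rfl

/-- From `Pᴴ G P = 1` the inverse of the Gram matrix is `P Pᴴ`. This eliminates the chosen
orthonormal basis, which may depend wildly on `H`, so that `f_k` along a curve can be differentiated
in a fixed basis. -/
lemma exists_gram_inv_eq [FiniteDimensional ℂ (HolSection n X k)] (H : HermInner n X k)
    {s : Fin (dimSection n X k) → HolSection n X k} (hs : Submodule.span ℂ (range s) = ⊤) :
    ∃ P, orthonormalBasis H = comb s P ∧ (P * Pᴴ) * gram H.inner s = 1 := by
  have ht := isOrthonormalBasis_iff.1 (isOrthonormalBasis_orthonormalBasis H)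
  obtain ⟨P, hP⟩ := exists_eq_comb hs (orthonormalBasis H)
  refine ⟨P, hP, ?_⟩
  rw [hP, gram_inner_comb] at ht
  rw [mul_assoc]
  exact mul_eq_one_comm.1 ht.1

lemma isUnit_det_gram [FiniteDimensional ℂ (HolSection n X k)] (H : HermInner n X k)
    {s : Fin (dimSection n X k) → HolSection n X k} (hs : Submodule.span ℂ (range s) = ⊤) :
    IsUnit (gram H.inner s).det := by
  obtain ⟨P, -, hP⟩ := exists_gram_inv_eq H hs
  exact Matrix.isUnit_det_of_left_inverse hP

/-- The map `f_k` in terms of an arbitrary basis. -/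
lemma fubiniStudy_eq [FiniteDimensional ℂ (HolSection n X k)] (h₀ : HermitianMetric n X)
    (H : HermInner n X k) {s : Fin (dimSection n X k) → HolSection n X k}
    (hs : Submodule.span ℂ (range s) = ⊤) (x : X) :
    fubiniStudy h₀ H x = (1 / (k : ℝ)) * Real.log ((1 / (dimSection n X k : ℝ)) *
      ((gram H.inner s)⁻¹ * gram (fun r r' => pointwiseInner h₀ r r' x) s).trace.re) := by
  obtain ⟨P, hP, hPG⟩ := exists_gram_inv_eq H hs
  have h1 : ∑ i, (pointwiseInner h₀ (orthonormalBasis H i) (orthonormalBasis H i) x).re =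
      bergman h₀ (orthonormalBasis H) x := rfl
  have h2 := gram_comb (pointwiseForm h₀ x) s P
  change gram (fun r r' => pointwiseInner h₀ r r' x) (comb s P) =
    Pᴴ * gram (fun r r' => pointwiseInner h₀ r r' x) s * P at h2
  rw [fubiniStudy, h1, ← trace_gram_pointwise, hP, h2, trace_mul_comm, ← mul_assoc,
    Matrix.inv_eq_left_inv hPG]

lemma fubiniStudy_eq_bergman [FiniteDimensional ℂ (HolSection n X k)] (h₀ : HermitianMetric n X)
    {H : HermInner n X k} {s : Fin (dimSection n X k) → HolSection n X k}
    (hs : IsOrthonormalBasis H s) (x : X) :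
    fubiniStudy h₀ H x = (1 / (k : ℝ)) * Real.log ((1 / (dimSection n X k : ℝ)) *
      bergman h₀ s x) := by
  rw [isOrthonormalBasis_iff] at hs
  rw [fubiniStudy_eq h₀ H hs.2, hs.1, inv_one, one_mul, trace_gram_pointwise]

lemma dimSection_pos [FiniteDimensional ℂ (HolSection n X k)] {x : X}
    (hx : ∃ s : HolSection n X k, coeff s x ≠ 0) : 0 < dimSection n X k := by
  obtain ⟨s, hs⟩ := hx
  have : Nontrivial (HolSection n X k) := ⟨s, 0, fun h => hs (by rw [h]; rfl)⟩
  exact Module.finrank_pos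

lemma continuous_fubiniStudy [FiniteDimensional ℂ (HolSection n X k)] (h₀ : HermitianMetric n X)
    (hbpf : ∀ x : X, ∃ s : HolSection n X k, coeff s x ≠ 0) (H : HermInner n X k) :
    Continuous (fubiniStudy h₀ H) := by
  obtain ⟨s, hs⟩ := exists_isOrthonormalBasis H
  rw [funext (fubiniStudy_eq_bergman h₀ hs)]
  refine continuous_const.mul ((continuous_const.mul (continuous_bergman h₀ s)).log fun x => ?_)
  have h1 := bergman_pos h₀ hs.span_eq_top (hbpf x)
  have h2 := dimSection_pos (hbpf x)
  exact (mul_pos (one_div_pos.2 (Nat.cast_pos.2 h2)) h1).ne'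

variable [CompactSpace X] [MeasurableSpace X] [BorelSpace X]

/-- The sesquilinear form `∫ h₀(s, s') κ dμ`. -/
def weightedForm (h₀ : HermitianMetric n X) (k : ℕ) (μ : Measure X) [IsFiniteMeasure μ]
    {κ : X → ℝ} (hκ : Continuous κ) : HolSection n X k →ₗ⋆[ℂ] HolSection n X k →ₗ[ℂ] ℂ :=
  have hi (s s' : HolSection n X k) : Integrable (fun x => κ x • pointwiseForm h₀ x s s') μ :=
    integrable_of_compactSpace (hκ.smul (continuous_pointwiseInner h₀ s s'))
  LinearMap.mk₂'ₛₗ (starRingEnd ℂ) (RingHom.id ℂ)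
    (fun s s' => ∫ x, κ x • pointwiseForm h₀ x s s' ∂μ)
    (fun s s' r => by
      rw [← integral_add (hi s r) (hi s' r)]
      simp only [map_add, LinearMap.add_apply, smul_add])
    (fun c s r => by
      rw [← integral_smul]
      simp only [LinearMap.map_smulₛₗ, LinearMap.smul_apply, smul_comm _ (starRingEnd ℂ c)])
    (fun s r r' => by
      rw [← integral_add (hi s r) (hi s r')]
      simp only [map_add, smul_add])
    (fun c s r => by
      rw [← integral_smul]
      simp only [map_smul, RingHom.id_apply, smul_comm _ c])

lemma conj_weightedForm (h₀ : HermitianMetric n X) (μ : Measure X) [IsFiniteMeasure μ]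
    {κ : X → ℝ} (hκ : Continuous κ) (s s' : HolSection n X k) :
    conj (weightedForm h₀ k μ hκ s' s) = weightedForm h₀ k μ hκ s s' := by
  change conj (∫ x, κ x • pointwiseInner h₀ s' s x ∂μ) = ∫ x, κ x • pointwiseInner h₀ s s' x ∂μ
  rw [← integral_conj]
  congr 1
  funext x
  rw [Complex.real_smul, map_mul, Complex.conj_ofReal, conj_pointwiseInner, Complex.real_smul]

lemma weightedForm_self (h₀ : HermitianMetric n X) (μ : Measure X) [IsFiniteMeasure μ]
    {κ : X → ℝ} (hκ : Continuous κ) (s : HolSection n X k) :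
    weightedForm h₀ k μ hκ s s = ((∫ x, κ x * normSq h₀ s x ∂μ : ℝ) : ℂ) := by
  change ∫ x, κ x • pointwiseInner h₀ s s x ∂μ = _
  rw [← integral_complex_ofReal]
  congr 1
  funext x
  rw [pointwiseInner_self, Complex.real_smul, Complex.ofReal_mul]

lemma integral_mul_normSq_pos (h₀ : HermitianMetric n X) (μ : Measure X) [IsFiniteMeasure μ]
    [μ.IsOpenPosMeasure] {κ : X → ℝ} (hκ : Continuous κ) (hpos : ∀ x, 0 < κ x)
    {s : HolSection n X k} (hs : s ≠ 0) : 0 < ∫ x, κ x * normSq h₀ s x ∂μ := by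
  obtain ⟨x, hx⟩ : ∃ x, coeff s x ≠ 0 := by
    by_contra! h
    exact hs (ext_coeff h)
  refine Continuous.integral_pos_of_hasCompactSupport_nonneg_nonzero (x := x)
    (hκ.mul (continuous_normSq h₀ s)) (HasCompactSupport.of_compactSpace _)
    (fun y => mul_nonneg (hpos y).le (normSq_nonneg h₀ s y)) ?_
  exact mul_ne_zero (hpos x).ne' fun h => hx (normSq_eq_zero.1 h)

variable [T2Space X]

/-- The density, with respect to `μ₀`, of the measure in the definition of `b_k(H)`. -/
def balancingDensity (h₀ : HermitianMetric n X) (ρ₀ : X → ℝ)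
    (s : Fin (dimSection n X k) → HolSection n X k) (H : HermInner n X k) (x : X) : ℝ :=
  (∫ y, Real.exp (-fubiniStudy h₀ H y) ∂(refMeasure h₀ ρ₀))⁻¹ *
    (Real.exp (-fubiniStudy h₀ H x) * ((dimSection n X k : ℝ) / bergman h₀ s x))

section

variable [FiniteDimensional ℂ (HolSection n X k)] {h₀ : HermitianMetric n X} {ρ₀ : X → ℝ}
  [IsFiniteMeasure (refMeasure h₀ ρ₀)] {H : HermInner n X k}
  {s : Fin (dimSection n X k) → HolSection n X k}

lemma continuous_balancingDensity (hbpf : ∀ x : X, ∃ s : HolSection n X k, coeff s x ≠ 0)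
    (hs : IsOrthonormalBasis H s) : Continuous (balancingDensity h₀ ρ₀ s H) :=
  continuous_const.mul ((Real.continuous_exp.comp (continuous_fubiniStudy h₀ hbpf H).neg).mul
    (continuous_const.div (continuous_bergman h₀ s) fun x =>
      (bergman_pos h₀ hs.span_eq_top (hbpf x)).ne'))

/-- As `k > 0`, the exponential undoes the logarithm: `e^{-k f_k}` is `N_k` over the Bergman
function. The balancing form is thus a sesquilinear `L²` form with continuous density. -/
lemma balancing_eq (hk : 0 < k) (hbpf : ∀ x : X, ∃ s : HolSection n X k, coeff s x ≠ 0)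
    (hs : IsOrthonormalBasis H s) (r r' : HolSection n X k) :
    balancing h₀ ρ₀ H r r' = weightedForm h₀ k (refMeasure h₀ ρ₀)
      (continuous_balancingDensity (h₀ := h₀) (ρ₀ := ρ₀) hbpf hs) r r' := by
  change _ = ∫ x, balancingDensity h₀ ρ₀ s H x • pointwiseInner h₀ r r' x ∂(refMeasure h₀ ρ₀)
  rw [balancing, l2Form, integral_canonicalMeasure h₀ ρ₀ (continuous_fubiniStudy h₀ hbpf H),
    ← integral_smul]
  congr 1
  funext x
  have h1 := bergman_pos h₀ hs.span_eq_top (hbpf x)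
  have h2 : (0 : ℝ) < dimSection n X k := Nat.cast_pos.2 (dimSection_pos (hbpf x))
  have hk' : (0 : ℝ) < k := Nat.cast_pos.2 hk
  have h3 : Real.exp (-(k * fubiniStudy h₀ H x)) = (dimSection n X k : ℝ) / bergman h₀ s x := by
    rw [fubiniStudy_eq_bergman h₀ hs, ← mul_assoc, mul_one_div_cancel hk'.ne', one_mul,
      Real.exp_neg, Real.exp_log (by positivity)]
    field_simp
  rw [h3, balancingDensity]
  simp only [Complex.real_smul, Complex.ofReal_mul]
  ring

lemma integral_exp_neg_fubiniStudy_pos [Nonempty X] [(refMeasure h₀ ρ₀).IsOpenPosMeasure]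
    (hbpf : ∀ x : X, ∃ s : HolSection n X k, coeff s x ≠ 0) :
    0 < ∫ y, Real.exp (-fubiniStudy h₀ H y) ∂(refMeasure h₀ ρ₀) :=
  Continuous.integral_pos_of_hasCompactSupport_nonneg_nonzero (x := Classical.arbitrary X)
    (Real.continuous_exp.comp (continuous_fubiniStudy h₀ hbpf H).neg)
    (HasCompactSupport.of_compactSpace _) (fun _ => (Real.exp_pos _).le) (Real.exp_pos _).ne'

lemma balancing_self (hk : 0 < k) (hbpf : ∀ x : X, ∃ s : HolSection n X k, coeff s x ≠ 0)
    (hs : IsOrthonormalBasis H s) (r : HolSection n X k) :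
    balancing h₀ ρ₀ H r r = ((∫ x, balancingDensity h₀ ρ₀ s H x * normSq h₀ r x
      ∂(refMeasure h₀ ρ₀) : ℝ) : ℂ) := by
  rw [balancing_eq hk hbpf hs, weightedForm_self]

lemma balancing_self_re_pos [Nonempty X] [(refMeasure h₀ ρ₀).IsOpenPosMeasure] (hk : 0 < k)
    (hbpf : ∀ x : X, ∃ s : HolSection n X k, coeff s x ≠ 0)
    (hs : IsOrthonormalBasis H s) {r : HolSection n X k} (hr : r ≠ 0) :
    0 < (balancing h₀ ρ₀ H r r).re := by
  rw [balancing_self hk hbpf hs, Complex.ofReal_re]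
  refine integral_mul_normSq_pos h₀ _ (continuous_balancingDensity hbpf hs) (fun x => ?_) hr
  have h1 := bergman_pos h₀ hs.span_eq_top (hbpf x)
  have h2 : (0 : ℝ) < dimSection n X k := Nat.cast_pos.2 (dimSection_pos (hbpf x))
  have h3 : 0 < ∫ y, Real.exp (-fubiniStudy h₀ H y) ∂(refMeasure h₀ ρ₀) :=
    integral_exp_neg_fubiniStudy_pos hbpf
  have h4 := Real.exp_pos (-fubiniStudy h₀ H x)
  unfold balancingDensity
  positivity

/-- The trace of `b_k(H)` with respect to `H` is `N_k`. -/
lemma sum_balancing_self_re [Nonempty X] [(refMeasure h₀ ρ₀).IsOpenPosMeasure] (hk : 0 < k)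
    (hbpf : ∀ x : X, ∃ s : HolSection n X k, coeff s x ≠ 0) (hs : IsOrthonormalBasis H s) :
    ∑ i, (balancing h₀ ρ₀ H (s i) (s i)).re = dimSection n X k := by
  simp only [balancing_self hk hbpf hs, Complex.ofReal_re]
  have hi (i : Fin (dimSection n X k)) :
      Integrable (fun x => balancingDensity h₀ ρ₀ s H x * normSq h₀ (s i) x) (refMeasure h₀ ρ₀) :=
    integrable_of_compactSpace
      ((continuous_balancingDensity hbpf hs).mul (continuous_normSq h₀ (s i)))
  rw [← integral_finsetSum _ fun i _ => hi i]
  have h3 : 0 < ∫ y, Real.exp (-fubiniStudy h₀ H y) ∂(refMeasure h₀ ρ₀) :=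
    integral_exp_neg_fubiniStudy_pos hbpf
  -- Summation over the basis cancels the Bergman function and leaves `N_k` times a probability
  -- density.
  have h4 (x : X) : ∑ i, balancingDensity h₀ ρ₀ s H x * normSq h₀ (s i) x =
      (∫ y, Real.exp (-fubiniStudy h₀ H y) ∂(refMeasure h₀ ρ₀))⁻¹ * (dimSection n X k : ℝ) *
        Real.exp (-fubiniStudy h₀ H x) := by
    have h1 := bergman_pos h₀ hs.span_eq_top (hbpf x)
    rw [← Finset.mul_sum]
    change balancingDensity h₀ ρ₀ s H x * bergman h₀ s x = _
    unfold balancingDensity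
    field_simp
  simp only [h4]
  rw [integral_const_mul]
  field_simp

lemma exists_isOrthonormalBasis_balancing_orthogonal (hk : 0 < k)
    (hbpf : ∀ x : X, ∃ s : HolSection n X k, coeff s x ≠ 0) (H : HermInner n X k) :
    ∃ s, IsOrthonormalBasis H s ∧ ∀ i j, i ≠ j → balancing h₀ ρ₀ H (s i) (s j) = 0 := by
  obtain ⟨s, hs⟩ := exists_isOrthonormalBasis H
  obtain ⟨t, ht, h⟩ := exists_isOrthonormalBasis_diagonal H
    (weightedForm h₀ k (refMeasure h₀ ρ₀)
      (continuous_balancingDensity (h₀ := h₀) (ρ₀ := ρ₀) hbpf hs))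
    (conj_weightedForm h₀ _ _)
  exact ⟨t, ht, fun i j hij => by rw [balancing_eq hk hbpf hs, h i j hij]⟩

lemma gram_balancing_eq_diagonal (hk : 0 < k)
    (hbpf : ∀ x : X, ∃ s : HolSection n X k, coeff s x ≠ 0) (hs : IsOrthonormalBasis H s)
    (hdiag : ∀ i j, i ≠ j → balancing h₀ ρ₀ H (s i) (s j) = 0) :
    gram (balancing h₀ ρ₀ H) s =
      Matrix.diagonal fun i => (((balancing h₀ ρ₀ H (s i) (s i)).re : ℝ) : ℂ) := by
  ext i j
  rw [gram, Matrix.of_apply]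
  rcases eq_or_ne i j with rfl | hij
  · rw [diagonal_apply_eq, balancing_self hk hbpf hs, Complex.ofReal_re]
  · rw [diagonal_apply_ne _ hij, hdiag i j hij]

/-- The quantized entropy in a basis which diagonalises `b_k(H)` and `H`. -/
lemma quantizedEntropy_eq [Nonempty X] [(refMeasure h₀ ρ₀).IsOpenPosMeasure] (hk : 0 < k)
    (hbpf : ∀ x : X, ∃ s : HolSection n X k, coeff s x ≠ 0) (hs : IsOrthonormalBasis H s)
    (hdiag : ∀ i j, i ≠ j → balancing h₀ ρ₀ H (s i) (s j) = 0) :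
    quantizedEntropy h₀ ρ₀ H = 1 / (dimSection n X k : ℝ) *
      ∑ i, (balancing h₀ ρ₀ H (s i) (s i)).re *
        Real.log (balancing h₀ ρ₀ H (s i) (s i)).re := by
  have hN : (0 : ℝ) < dimSection n X k :=
    Nat.cast_pos.2 (dimSection_pos (hbpf (Classical.arbitrary X)))
  have ht := isOrthonormalBasis_orthonormalBasis H
  -- The entropy is defined in the chosen orthonormal basis; it differs from `s` by a unitary
  -- matrix, under which the relative entropy is invariant.
  obtain ⟨P, hP, htP⟩ := hs.exists_comb ht
  have h1 : gram (balancing h₀ ρ₀ H) (orthonormalBasis H) = Pᴴ * Matrix.diagonal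
      (fun i => (((balancing h₀ ρ₀ H (s i) (s i)).re : ℝ) : ℂ)) * P := by
    rw [← gram_balancing_eq_diagonal hk hbpf hs hdiag, htP]
    have h2 : balancing h₀ ρ₀ H = fun r r' => weightedForm h₀ k (refMeasure h₀ ρ₀)
        (continuous_balancingDensity (h₀ := h₀) (ρ₀ := ρ₀) hbpf hs) r r' := by
      funext r r'
      exact balancing_eq hk hbpf hs r r'
    rw [h2]
    exact gram_comb _ s P
  rw [quantizedEntropy, h1, (isOrthonormalBasis_iff.1 ht).1]
  have h3 := relEntropy_conj_diagonal hP
    (fun i => balancing_self_re_pos hk hbpf hs (hs.ne_zero i)) (one_div_pos.2 hN) (d := fun i =>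
      (balancing h₀ ρ₀ H (s i) (s i)).re)
  rw [← h3]
  simp

end

end Balancing

/-! ### First variation of `L ∘ f_k` -/

section Flow

open Filter Topology Matrix

variable {n : ℕ} {X : Type*} [TopologicalSpace X] [ChartedSpace (Fin n → ℂ) X]
  [IsManifold 𝓘(ℂ, Fin n → ℂ) ω X] {k : ℕ}

/-- The real linear form `A ↦ Re tr (A Q(x))`, where `Q(x)` is the matrix of the pointwise products
of the sections `sᵢ`. -/
def traceForm (h₀ : HermitianMetric n X) {ι : Type*} [Fintype ι] (s : ι → HolSection n X k) (x : X) :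
    (ι → ι → ℂ) →L[ℝ] ℝ :=
  ∑ i, ∑ j, Complex.reCLM.comp (pointwiseInner h₀ (s j) (s i) x •
    (ContinuousLinearMap.proj (R := ℝ) (φ := fun _ : ι => ℂ) j).comp
      (ContinuousLinearMap.proj (R := ℝ) (φ := fun _ : ι => ι → ℂ) i))

lemma traceForm_apply (h₀ : HermitianMetric n X) {ι : Type*} [Fintype ι]
    (s : ι → HolSection n X k) (x : X) (A : Matrix ι ι ℂ) :
    traceForm h₀ s x (Matrix.of.symm A) = (A * gram (fun r r' => pointwiseInner h₀ r r' x) s).trace.re := by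
  simp only [traceForm, _root_.sum_apply, ContinuousLinearMap.comp_apply,
    _root_.smul_apply, ContinuousLinearMap.proj_apply, Complex.reCLM_apply, trace,
    Complex.re_sum, diag_apply, Matrix.mul_apply, gram, Matrix.of_apply, smul_eq_mul,
    Matrix.of_symm_apply]
  exact Finset.sum_congr rfl fun i _ => Finset.sum_congr rfl fun j _ => by rw [mul_comm]

lemma continuous_traceForm (h₀ : HermitianMetric n X) {ι : Type*} [Fintype ι]
    (s : ι → HolSection n X k) : Continuous (traceForm h₀ s) :=
  continuous_finsetSum _ fun i _ => continuous_finsetSum _ fun j _ =>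
    continuous_const.clm_comp ((continuous_pointwiseInner h₀ (s j) (s i)).smul continuous_const)

lemma traceForm_one (h₀ : HermitianMetric n X) {ι : Type*} [Fintype ι] [DecidableEq ι]
    (s : ι → HolSection n X k) (x : X) :
    traceForm h₀ s x (Matrix.of.symm 1) = bergman h₀ s x := by
  rw [traceForm_apply, one_mul, trace_gram_pointwise]

lemma traceForm_diagonal (h₀ : HermitianMetric n X) {ι : Type*} [Fintype ι] [DecidableEq ι]
    (s : ι → HolSection n X k) (x : X) (d : ι → ℝ) :
    traceForm h₀ s x (Matrix.of.symm (Matrix.diagonal fun i => (d i : ℂ))) = ∑ i, d i * normSq h₀ (s i) x := by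
  rw [traceForm_apply, trace, Complex.re_sum]
  refine Finset.sum_congr rfl fun i _ => ?_
  rw [diag_apply, diagonal_mul, gram, Matrix.of_apply, pointwiseInner_self, ← Complex.ofReal_mul,
    Complex.ofReal_re]

variable [CompactSpace X] [T2Space X] [MeasurableSpace X] [BorelSpace X]
  [FiniteDimensional ℂ (HolSection n X k)] {h₀ : HermitianMetric n X} {ρ₀ : X → ℝ}
  [IsFiniteMeasure (refMeasure h₀ ρ₀)] [(refMeasure h₀ ρ₀).IsOpenPosMeasure]

/-- Derivative of the functional `L ∘ f_k` along a curve of inner products whose derivative at `t` is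
diagonal in an `H_t`-orthonormal and `b_k(H_t)`-orthogonal basis. -/
lemma hasDerivWithinAt_LFunctional [Nonempty X] (hk : 0 < k) (hV : 0 < kahlerVolume h₀)
    (hbpf : ∀ x : X, ∃ s : HolSection n X k, coeff s x ≠ 0) {H : ℝ → HermInner n X k} {I : Set ℝ}
    {t : ℝ} {s : Fin (dimSection n X k) → HolSection n X k} (hs : IsOrthonormalBasis (H t) s)
    {d : Fin (dimSection n X k) → ℝ}
    (hd : ∀ i j, HasDerivWithinAt (fun τ => (H τ).inner (s i) (s j))
      (Matrix.diagonal (fun i => (d i : ℂ)) i j) I t) :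
    HasDerivWithinAt (fun τ => LFunctional h₀ ρ₀ (fubiniStudy h₀ (H τ)))
      (-(1 / ((k : ℝ) * (dimSection n X k : ℝ)) *
        ∑ i, (balancing h₀ ρ₀ (H t) (s i) (s i)).re * d i)) I t := by
  have hN : (0 : ℝ) < dimSection n X k :=
    Nat.cast_pos.2 (dimSection_pos (hbpf (Classical.arbitrary X)))
  have hk' : (0 : ℝ) < k := Nat.cast_pos.2 hk
  have hspan := hs.span_eq_top
  have hρ (x : X) : 0 < bergman h₀ s x := bergman_pos h₀ hspan (hbpf x)
  have hG1 := (isOrthonormalBasis_iff.1 hs).1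
  -- The basis `s` stays fixed and is orthonormal only at time `t`. `Matrix.of.symm` places the
  -- inverse Gram matrix in the normed space of functions where the derivative is taken.
  let A : ℝ → Fin (dimSection n X k) → Fin (dimSection n X k) → ℂ := fun τ =>
    Matrix.of.symm (gram (H τ).inner s)⁻¹
  have hA1 : A t = Matrix.of.symm 1 := by
    simp only [A, hG1, inv_one]
  have hAd : HasDerivWithinAt A (-Matrix.of.symm (Matrix.diagonal fun i => (d i : ℂ))) I t :=
    hasDerivWithinAt_pi.2 fun i => hasDerivWithinAt_pi.2 fun j =>
      hasDerivWithinAt_matrix_inv (G := fun τ => gram (H τ).inner s)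
        (fun τ => isUnit_det_gram (H τ) hspan) hG1 hd i j
  have hΦ := hasFDerivAt_integral_exp_log (μ := refMeasure h₀ ρ₀) (continuous_traceForm h₀ s)
    (A₀ := A t) (fun x => by rw [hA1, traceForm_one]; exact hρ x) (1 / (k : ℝ)) (one_div_pos.2 hN)
  have hfs (τ : ℝ) (x : X) : fubiniStudy h₀ (H τ) x = (1 / (k : ℝ)) *
      Real.log ((1 / (dimSection n X k : ℝ)) * traceForm h₀ s x (A τ)) := by
    rw [fubiniStudy_eq h₀ (H τ) hspan]
    congr 3
    exact (traceForm_apply h₀ s x _).symm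
  have hcomp := hΦ.comp_hasDerivWithinAt t hAd
  simp only [Function.comp_def, ← hfs] at hcomp
  set Z := ∫ y, Real.exp (-fubiniStudy h₀ (H t) y) ∂(refMeasure h₀ ρ₀) with hZ
  have hZpos : 0 < Z := integral_exp_neg_fubiniStudy_pos hbpf
  have hcf := continuous_fubiniStudy h₀ hbpf (H t)
  have hce : Continuous fun x => Real.exp (-fubiniStudy h₀ (H t) x) :=
    Real.continuous_exp.comp hcf.neg
  have hcρ := continuous_bergman h₀ s
  -- The minus sign of the exponent and that of the derivative of `G⁻¹` cancel. The integrand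
  -- `e^{-f_k} |s_i|² / ∑ |s_j|²` is `Z / N_k` times the one defining the diagonal entry of `b_k`.
  have hderiv : (∫ x, (Real.exp (-fubiniStudy h₀ (H t) x) *
      (-((1 / (k : ℝ)) / traceForm h₀ s x (A t)))) • traceForm h₀ s x ∂(refMeasure h₀ ρ₀))
        (-Matrix.of.symm (Matrix.diagonal fun i => (d i : ℂ))) =
      Z * (1 / ((k : ℝ) * (dimSection n X k : ℝ)) *
        ∑ i, (balancing h₀ ρ₀ (H t) (s i) (s i)).re * d i) := by
    have hc : Continuous fun x => (Real.exp (-fubiniStudy h₀ (H t) x) *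
        (-((1 / (k : ℝ)) / traceForm h₀ s x (A t)))) • traceForm h₀ s x := by
      simp only [hA1, traceForm_one]
      exact (hce.mul (continuous_const.div hcρ fun x => (hρ x).ne').neg).smul
        (continuous_traceForm h₀ s)
    rw [ContinuousLinearMap.integral_apply (integrable_of_compactSpace hc)]
    simp only [balancing_self hk hbpf hs, Complex.ofReal_re, ← integral_mul_const]
    have hi (i : Fin (dimSection n X k)) :
        Integrable (fun x => balancingDensity h₀ ρ₀ s (H t) x * normSq h₀ (s i) x * d i)
          (refMeasure h₀ ρ₀) :=
      integrable_of_compactSpace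
        (((continuous_balancingDensity hbpf hs).mul (continuous_normSq h₀ (s i))).mul
          continuous_const)
    rw [← integral_finsetSum _ fun i _ => hi i, ← integral_const_mul, ← integral_const_mul]
    congr 1
    funext x
    have hx := (hρ x).ne'
    rw [_root_.smul_apply, map_neg, traceForm_diagonal, hA1, traceForm_one,
      smul_eq_mul, balancingDensity, ← hZ, Finset.mul_sum, Finset.mul_sum, ← Finset.sum_neg_distrib,
      Finset.mul_sum]
    refine Finset.sum_congr rfl fun i _ => ?_
    field_simp
  rw [hderiv] at hcomp
  -- In the logarithmic derivative the volume and `Z` both drop out.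
  have hlog := ((hcomp.const_mul (kahlerVolume h₀)⁻¹).log
    (mul_pos (inv_pos.2 hV) hZpos).ne').neg
  rw [← hZ] at hlog
  refine hlog.congr_deriv ?_
  have hV' := hV.ne'
  have hZ' := hZpos.ne'
  field_simp

end Flow

end QuantizedKRF

end

theorem mainTheorem5 {n : ℕ} {X : Type*} [TopologicalSpace X] [CompactSpace X] [T2Space X]
    [ConnectedSpace X] [ChartedSpace (Fin n → ℂ) X] [IsManifold 𝓘(ℂ, Fin n → ℂ) ω X]
    [MeasurableSpace X] [BorelSpace X]
    (h₀ : QuantizedKRF.HermitianMetric n X) (hpos : h₀.IsPositive)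
    (ρ₀ : X → ℝ) (hρ₀ : QuantizedKRF.IsRicciPotential h₀ ρ₀)
    (k : ℕ) (hk : 0 < k)
    (hbpf : ∀ x : X, ∃ s : QuantizedKRF.HolSection n X k, QuantizedKRF.coeff s x ≠ 0)
    (I : Set ℝ) (H : ℝ → QuantizedKRF.HermInner n X k)
    (hflow : QuantizedKRF.IsQuantizedFlowOn h₀ ρ₀ I H) :
    ∀ t ∈ I,
      HasDerivWithinAt
        (fun τ => QuantizedKRF.LFunctional h₀ ρ₀ (QuantizedKRF.fubiniStudy h₀ (H τ)))
        (-QuantizedKRF.quantizedEntropy h₀ ρ₀ (H t)) I t ∧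
      (∃ s, QuantizedKRF.IsOrthonormalBasis (H t) s ∧
        ∀ i j, i ≠ j → QuantizedKRF.balancing h₀ ρ₀ (H t) (s i) (s j) = 0) ∧
      ∀ s, QuantizedKRF.IsOrthonormalBasis (H t) s →
        (∀ i j, i ≠ j → QuantizedKRF.balancing h₀ ρ₀ (H t) (s i) (s j) = 0) →
        ∀ lam : Fin (QuantizedKRF.dimSection n X k) → ℝ,
          (∀ i, lam i = -(k : ℝ) *
            Real.log (QuantizedKRF.balancing h₀ ρ₀ (H t) (s i) (s i)).re) →
          QuantizedKRF.quantizedEntropy h₀ ρ₀ (H t) =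
            -(∑ i, lam i / k * ((QuantizedKRF.balancing h₀ ρ₀ (H t) (s i) (s i)).re /
                (QuantizedKRF.dimSection n X k : ℝ))) -
              Real.log ((1 / (QuantizedKRF.dimSection n X k : ℝ)) *
                ∑ i, Real.exp (-(lam i) / k)) := by
  intro t ht
  have hX : Nonempty X := inferInstance
  have hfd := QuantizedKRF.finiteDimensional_holSection h₀ k
  have hfin := QuantizedKRF.isFiniteMeasure_refMeasure h₀ hρ₀.continuous
  have hopen := QuantizedKRF.isOpenPosMeasure_refMeasure hpos hρ₀.continuous
  have hk' : (0 : ℝ) < k := Nat.cast_pos.2 hk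
  have hN : (0 : ℝ) < QuantizedKRF.dimSection n X k :=
    Nat.cast_pos.2 (QuantizedKRF.dimSection_pos (hbpf (Classical.arbitrary X)))
  have hex := QuantizedKRF.exists_isOrthonormalBasis_balancing_orthogonal (h₀ := h₀) (ρ₀ := ρ₀)
    hk hbpf (H t)
  refine ⟨?_, hex, ?_⟩
  · obtain ⟨s, hs, hdiag⟩ := hex
    have hd := hflow t ht s hs
    -- In this basis `log H_t` vanishes and `log b_k(H_t)` is diagonal, so the flow gives a diagonal
    -- derivative.
    rw [QuantizedKRF.gram_balancing_eq_diagonal hk hbpf hs hdiag,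
      (QuantizedKRF.isOrthonormalBasis_iff.1 hs).1, QuantizedKRF.matLog_one,
      QuantizedKRF.matLog_diagonal, sub_zero] at hd
    refine (QuantizedKRF.hasDerivWithinAt_LFunctional (ρ₀ := ρ₀) hk
      (QuantizedKRF.kahlerVolume_pos hpos) hbpf hs (I := I) (d := fun i => (k : ℝ) *
        Real.log (QuantizedKRF.balancing h₀ ρ₀ (H t) (s i) (s i)).re) fun i j => ?_).congr_deriv ?_
    · refine (hd i j).congr_deriv ?_
      rcases eq_or_ne i j with rfl | hij
      · simp only [Matrix.diagonal_apply_eq, Complex.ofReal_mul, Complex.ofReal_natCast]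
      · simp only [Matrix.diagonal_apply_ne _ hij, mul_zero]
    · rw [QuantizedKRF.quantizedEntropy_eq hk hbpf hs hdiag, Finset.mul_sum, Finset.mul_sum]
      congr 1
      refine Finset.sum_congr rfl fun i _ => ?_
      field_simp
  · intro s hs hdiag lam hlam
    have hb (i) : 0 < (QuantizedKRF.balancing h₀ ρ₀ (H t) (s i) (s i)).re :=
      QuantizedKRF.balancing_self_re_pos hk hbpf hs (hs.ne_zero i)
    have hexp (i) : Real.exp (-(lam i) / k) =
        (QuantizedKRF.balancing h₀ ρ₀ (H t) (s i) (s i)).re := by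
      rw [hlam i, neg_mul, neg_neg, mul_div_cancel_left₀ _ hk'.ne', Real.exp_log (hb i)]
    simp only [hexp]
    -- The exponentials are the eigenvalues of `b_k(H_t)`, whose mean is `1`, so the logarithmic
    -- term is zero.
    rw [QuantizedKRF.sum_balancing_self_re hk hbpf hs, one_div_mul_cancel hN.ne', Real.log_one,
      sub_zero, QuantizedKRF.quantizedEntropy_eq hk hbpf hs hdiag, Finset.mul_sum,
      ← Finset.sum_neg_distrib]
    refine Finset.sum_congr rfl fun i _ => ?_
    rw [hlam i]
    field_simp
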